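/- Let $P$ be a set of $n\ge 3$ points in the plane, no three on a line, and let $T$ be a full triangulation of $P$, i.e., an edge-maximal graph with vertex set $P$ such that the straight line segments representing its edges are pairwise disjoint except for possibly sharing an endpoint. An edge $e$ of $T$ that is not an edge of the convex hull of $P$ is called flippable in $T$ if removing $e$ from $T$ creates a convex quadrilateral region $Q$; in this case $T[e]$ denotes the triangulation obtained from $T$ by replacing $e$ with the other diagonal of $Q$. Two distinct flippable edges $e,f$ of $T$ are called independently flippable in $T$ if $f$ is flippable in $T[e]$, $e$ is flippable in $T[f]$, and $(T[e])[f]=(T[f])[e]$. A set of flippable edges of $T$ is called simultaneously flippable if its elements are pairwise independently flippable. If $\alpha$ is the number of flippable edges in $T$ and $\beta$ is the size of a largest set of simultaneously flippable edges in $T$, then $$\alpha+\beta\ \ge\ \frac{4(n-4)}{5}.$$ -/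

import Mathlib

namespace PlaneTriangulation

/-- The Euclidean plane. -/
abbrev Plane : Type := EuclideanSpace ℝ (Fin 2)

/-- No three distinct points of `P` lie on a line. -/
def GeneralPosition (P : Finset Plane) : Prop :=
  ∀ a ∈ P, ∀ b ∈ P, ∀ c ∈ P, a ≠ b → a ≠ c → b ≠ c → ¬ Collinear ℝ ({a, b, c} : Set Plane)

variable {P : Finset Plane}

/-- The closed straight line segment corresponding to an unordered pair of points of `P`. -/
def edgeSegment (e : Sym2 P) : Set Plane :=
  Sym2.lift ⟨fun a b : P => segment ℝ (a : Plane) (b : Plane),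
    fun a b => segment_symm ℝ (a : Plane) (b : Plane)⟩ e

/-- A graph on `P` is plane if the segments of any two different edges are disjoint except for
possibly sharing an endpoint. -/
def IsPlane (G : SimpleGraph P) : Prop :=
  ∀ e ∈ G.edgeSet, ∀ f ∈ G.edgeSet, e ≠ f →
    ∀ x ∈ edgeSegment e ∩ edgeSegment f, ∃ p : P, p ∈ e ∧ p ∈ f ∧ x = (p : Plane)

/-- The union of the segments of all edges of `G`. -/
def edgeUnion (G : SimpleGraph P) : Set Plane :=
  ⋃ e ∈ G.edgeSet, edgeSegment e

/-- The regions of `G`: the bounded connected components of the complement of the union of the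
edges. -/
def regions (G : SimpleGraph P) : Set (Set Plane) :=
  {R | Bornology.IsBounded R ∧ ∃ x ∈ (edgeUnion G)ᶜ, R = connectedComponentIn (edgeUnion G)ᶜ x}

/-- A full triangulation of `P`: a maximal plane graph with vertex set `P`. -/
def IsFullTriangulation (T : SimpleGraph P) : Prop :=
  Maximal IsPlane T

/-- The pair `e` is an edge of the convex hull of `P`. -/
def IsHullEdge (e : Sym2 P) : Prop :=
  ¬ e.IsDiag ∧ edgeSegment e ⊆ frontier (convexHull ℝ (P : Set Plane))

/-- The inner edges of `T`: those that are not edges of the convex hull of `P`. -/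
def innerEdges (T : SimpleGraph P) : Set (Sym2 P) :=
  {e ∈ T.edgeSet | ¬ IsHullEdge e}

/-- Removing the inner edge `e` from `T` creates a convex quadrilateral region `Q`, and `e'` is the
diagonal of `Q` other than `e`. Four points with no three on a line are the vertices of a convex
quadrilateral with diagonals `ab` and `cd` exactly if the open segments `ab` and `cd` meet; as an
open set the quadrilateral is then the interior of the convex hull of the four points. -/
def IsOtherDiagonal (T : SimpleGraph P) (e e' : Sym2 P) : Prop :=
  e ∈ innerEdges T ∧
  ∃ a b c d : P, e = s(a, b) ∧ e' = s(c, d) ∧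
    (openSegment ℝ (a : Plane) (b : Plane) ∩ openSegment ℝ (c : Plane) (d : Plane)).Nonempty ∧
    interior (convexHull ℝ ({(a : Plane), (b : Plane), (c : Plane), (d : Plane)} : Set Plane)) ∈
      regions (T.deleteEdges {e})

/-- The edge `e` is flippable in `T`. -/
def IsFlippable (T : SimpleGraph P) (e : Sym2 P) : Prop :=
  ∃ e', IsOtherDiagonal T e e'

/-- `T'` is the result of the edge flip of `e` in `T` (so `e` is flippable in `T`): the edge `e` is
replaced by the other diagonal. -/
def IsFlip (T : SimpleGraph P) (e : Sym2 P) (T' : SimpleGraph P) : Prop :=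
  ∃ e', IsOtherDiagonal T e e' ∧ T' = T.deleteEdges {e} ⊔ SimpleGraph.fromEdgeSet {e'}

/-- The distinct edges `e` and `f` are independently flippable in `T`: both are flippable in `T`,
each of them remains flippable after the other one has been flipped, and the two orders of flipping
give the same triangulation. -/
def IndependentlyFlippable (T : SimpleGraph P) (e f : Sym2 P) : Prop :=
  e ≠ f ∧ ∃ Te Tf Tef : SimpleGraph P,
    IsFlip T e Te ∧ IsFlip T f Tf ∧ IsFlip Te f Tef ∧ IsFlip Tf e Tef

/-- A set of flippable edges of `T` that are pairwise independently flippable. -/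
def SimultaneouslyFlippable (T : SimpleGraph P) (F : Set (Sym2 P)) : Prop :=
  (∀ e ∈ F, IsFlippable T e) ∧ F.Pairwise (IndependentlyFlippable T)

end PlaneTriangulation

namespace PlaneTriangulation

/-! A double count of faces, hull edges and reflex angles is combined with a matching bound in the
dual graph. Let `n` be the number of points, `f` the number of triangular faces and `h` the number
of hull edges.

An edge with points of `P` on both sides bounds two empty triangles of edges (`exists_face`). Either
they form a convex quadrilateral, so that the edge is flippable, or the quadrilateral has a reflex
angle at exactly one end of the edge. Let `m` count the edges of the first kind and `r` those of the
second. Counting directed edges gives `3f + h ≤ 2h + 2r + 2m`.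

Reflex angles are scarce. There is none at a hull vertex, and two edges with a reflex angle at the
same vertex `v` must bound a common face (`IsReflex.isFace_or`). If `b` counts the faces having two
reflex edges at one corner, then `2r ≤ 3(n - h) + b`. Hence `2m ≥ 3f + 2h - 3n - b`.

Two flippable edges without a common face can be flipped independently, since neither flip disturbs
the quadrilateral of the other. So a matching `M` in the dual graph, with faces as nodes and
flippable edges as edges, is simultaneously flippable. This graph has maximum degree three, and a
greedy argument (`exists_matching`) yields `3m ≤ 5|M| + 4ρ`, where `ρ` is the number of faces with
at least two flippable edges. A face counted by `b` has at most one flippable edge, so `ρ + b ≤ f`.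

Finally `f + h ≥ 2n - 2`. This is proved without Euler's formula, by charging each vertex to a face
or hull edge in a sweep along a generic linear function (`six_mul_card_le`). The terms in `b`
cancel: `5(m + |M|) ≥ 8m - 4ρ ≥ 8(f + h) - 12n ≥ 4n - 16`. -/

/-! ### Signed areas, affine functions and affine frames -/

/-- Twice the signed area of the triangle `abc`; positive when `c` lies to the left of `ab`. -/
def det3 (a b c : Plane) : ℝ := (b 0 - a 0) * (c 1 - a 1) - (b 1 - a 1) * (c 0 - a 0)

lemma det3_rotate (a b c : Plane) : det3 b c a = det3 a b c := by unfold det3; ring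
lemma det3_swap (a b c : Plane) : det3 b a c = -det3 a b c := by unfold det3; ring
lemma det3_swap' (a b c : Plane) : det3 a c b = -det3 a b c := by unfold det3; ring
@[simp] lemma det3_self_left (a b : Plane) : det3 a a b = 0 := by unfold det3; ring
@[simp] lemma det3_self_right (a b : Plane) : det3 a b b = 0 := by unfold det3; ring
@[simp] lemma det3_self_outer (a b : Plane) : det3 a b a = 0 := by unfold det3; ring

lemma plane_ext {a b : Plane} (h0 : a 0 = b 0) (h1 : a 1 = b 1) : a = b := by
  ext i; fin_cases i <;> simpa

lemma lineMap_coord (a b : Plane) (t : ℝ) (i : Fin 2) :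
    (AffineMap.lineMap a b t : Plane) i = (1 - t) * a i + t * b i := by
  simp [AffineMap.lineMap_apply]; ring

/-- Real affine functions on the plane, in coordinates. -/
def IsAff (f : Plane → ℝ) : Prop := ∃ α β γ : ℝ, ∀ u : Plane, f u = α + β * u 0 + γ * u 1

lemma IsAff.lineMap {f : Plane → ℝ} (hf : IsAff f) (a b : Plane) (t : ℝ) :
    f (AffineMap.lineMap a b t) = (1 - t) * f a + t * f b := by
  obtain ⟨α, β, γ, h⟩ := hf
  rw [h, h, h, lineMap_coord, lineMap_coord]; ring

lemma IsAff.continuous {f : Plane → ℝ} (hf : IsAff f) : Continuous f := by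
  obtain ⟨α, β, γ, h⟩ := hf
  have : f = fun u => α + β * u 0 + γ * u 1 := funext h
  rw [this]; fun_prop

lemma isAff_const (c : ℝ) : IsAff (fun _ => c) := ⟨c, 0, 0, fun u => by ring⟩

lemma IsAff.add {f g : Plane → ℝ} (hf : IsAff f) (hg : IsAff g) : IsAff (fun u => f u + g u) := by
  obtain ⟨α, β, γ, h⟩ := hf
  obtain ⟨α', β', γ', h'⟩ := hg
  exact ⟨α + α', β + β', γ + γ', fun u => by simp only [h, h']; ring⟩

lemma IsAff.const_mul {f : Plane → ℝ} (hf : IsAff f) (c : ℝ) : IsAff (fun u => c * f u) := by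
  obtain ⟨α, β, γ, h⟩ := hf
  exact ⟨c * α, c * β, c * γ, fun u => by simp only [h]; ring⟩

lemma IsAff.neg {f : Plane → ℝ} (hf : IsAff f) : IsAff (fun u => -f u) := by
  simpa using hf.const_mul (-1)

lemma IsAff.sub {f g : Plane → ℝ} (hf : IsAff f) (hg : IsAff g) : IsAff (fun u => f u - g u) := by
  simpa [sub_eq_add_neg] using hf.add hg.neg

lemma isAff_det3 (a b : Plane) : IsAff (det3 a b) :=
  ⟨-(b 0 - a 0) * a 1 + (b 1 - a 1) * a 0, -(b 1 - a 1), b 0 - a 0,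
    fun u => by unfold det3; ring⟩

lemma mem_segment_iff {a b x : Plane} :
    x ∈ segment ℝ a b ↔ ∃ t : ℝ, 0 ≤ t ∧ t ≤ 1 ∧ AffineMap.lineMap a b t = x := by
  rw [segment_eq_image_lineMap]; simp [and_assoc]

lemma mem_openSegment_iff {a b x : Plane} :
    x ∈ openSegment ℝ a b ↔ ∃ t : ℝ, 0 < t ∧ t < 1 ∧ AffineMap.lineMap a b t = x := by
  rw [openSegment_eq_image_lineMap]; simp [and_assoc]

/-- Three affine functions that are positive at `u` but not all positive at `r`: on the way from
`u` to `r` there is a first point where one of them vanishes. -/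
lemma exists_exit {f g h : Plane → ℝ} (hf : IsAff f) (hg : IsAff g) (hh : IsAff h) {u r : Plane}
    (fu : 0 < f u) (gu : 0 < g u) (hu : 0 < h u) (hr : ¬ (0 < f r ∧ 0 < g r ∧ 0 < h r)) :
    ∃ t : ℝ, 0 < t ∧ t ≤ 1 ∧
      0 ≤ f (AffineMap.lineMap u r t) ∧ 0 ≤ g (AffineMap.lineMap u r t) ∧
      0 ≤ h (AffineMap.lineMap u r t) ∧
      (f (AffineMap.lineMap u r t) = 0 ∨ g (AffineMap.lineMap u r t) = 0 ∨
        h (AffineMap.lineMap u r t) = 0) := by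
  -- Any zero of the minimum serves: there all three functions are nonnegative and one vanishes. The
  -- intermediate value theorem provides it.
  let m : ℝ → ℝ := fun t => min (f (AffineMap.lineMap u r t))
    (min (g (AffineMap.lineMap u r t)) (h (AffineMap.lineMap u r t)))
  have hm : Continuous m := by
    simp only [m, hf.lineMap, hg.lineMap, hh.lineMap]; fun_prop
  have h0 : 0 < m 0 := by simp [m, fu, gu, hu]
  have h1 : m 1 ≤ 0 := by
    by_contra hc
    push Not at hc
    simp [m] at hc
    exact hr hc
  obtain ⟨t, ⟨ht0, ht1⟩, ht⟩ := intermediate_value_Icc' (zero_le_one' ℝ) hm.continuousOn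
    (show (0 : ℝ) ∈ Set.Icc (m 1) (m 0) from ⟨h1, h0.le⟩)
  have hpos : 0 < t := by
    rcases ht0.lt_or_eq with h | h
    · exact h
    · subst h; exact absurd ht h0.ne'
  have e : min (f (AffineMap.lineMap u r t))
    (min (g (AffineMap.lineMap u r t)) (h (AffineMap.lineMap u r t))) = 0 := ht
  refine ⟨t, hpos, ht1, ?_, ?_, ?_, ?_⟩
  · rw [← e]; exact min_le_left _ _
  · rw [← e]; exact (min_le_right _ _).trans (min_le_left _ _)
  · rw [← e]; exact (min_le_right _ _).trans (min_le_right _ _)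
  · rcases min_choice (f (AffineMap.lineMap u r t))
      (min (g (AffineMap.lineMap u r t)) (h (AffineMap.lineMap u r t))) with h' | h'
    · left; rw [← h', e]
    · right
      rcases min_choice (g (AffineMap.lineMap u r t)) (h (AffineMap.lineMap u r t)) with h'' | h''
      · left; rw [← h'', ← h', e]
      · right; rw [← h'', ← h', e]

/-- First coordinate of `u` in the affine frame with origin `v` and axes through `x`, `y`. -/
noncomputable def coordX (v x y u : Plane) : ℝ := det3 v u y / det3 v x y
/-- Second coordinate of `u` in the affine frame with origin `v` and axes through `x`, `y`. -/
noncomputable def coordY (v x y u : Plane) : ℝ := det3 v x u / det3 v x y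

lemma isAff_coordX (v x y : Plane) : IsAff (coordX v x y) := by
  have : coordX v x y = fun u => (det3 v x y)⁻¹ * det3 y v u := by
    funext u; rw [coordX, div_eq_inv_mul, ← det3_rotate v u y, ← det3_rotate u y v]
  rw [this]; exact (isAff_det3 y v).const_mul _

lemma isAff_coordY (v x y : Plane) : IsAff (coordY v x y) := by
  have : coordY v x y = fun u => (det3 v x y)⁻¹ * det3 v x u := by
    funext u; rw [coordY, div_eq_inv_mul]
  rw [this]; exact (isAff_det3 v x).const_mul _

lemma frame_eq {v x y : Plane} (h : det3 v x y ≠ 0) (u : Plane) (i : Fin 2) :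
    u i = v i + coordX v x y u * (x i - v i) + coordY v x y u * (y i - v i) := by
  unfold coordX coordY
  fin_cases i <;> field_simp <;> unfold det3 <;> simp only [Fin.isValue, Fin.zero_eta, Fin.mk_one] <;> ring

lemma IsAff.frame {g : Plane → ℝ} (hg : IsAff g) {v x y : Plane} (h : det3 v x y ≠ 0) (u : Plane) :
    g u = g v + coordX v x y u * (g x - g v) + coordY v x y u * (g y - g v) := by
  obtain ⟨α, β, γ, e⟩ := hg
  rw [e, e v, e x, e y]
  linear_combination β * frame_eq h u 0 + γ * frame_eq h u 1


lemma coordX_self (v x y : Plane) : coordX v x y v = 0 := by simp [coordX]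
lemma coordY_self (v x y : Plane) : coordY v x y v = 0 := by simp [coordY]
lemma coordY_left (v x y : Plane) : coordY v x y x = 0 := by simp [coordY]
lemma coordX_right (v x y : Plane) : coordX v x y y = 0 := by simp [coordX]
lemma coordX_left {v x y : Plane} (h : det3 v x y ≠ 0) : coordX v x y x = 1 := by
  simp [coordX, h]
lemma coordY_right {v x y : Plane} (h : det3 v x y ≠ 0) : coordY v x y y = 1 := by
  simp [coordY, h]

lemma eq_lineMap_of_coordY_eq_zero {v x y u : Plane} (h : det3 v x y ≠ 0)
    (hu : coordY v x y u = 0) : AffineMap.lineMap v x (coordX v x y u) = u := by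
  apply plane_ext <;> rw [lineMap_coord]
  · rw [frame_eq h u 0, hu]; ring
  · rw [frame_eq h u 1, hu]; ring

lemma eq_lineMap_of_coord_sum {v x y u : Plane} (h : det3 v x y ≠ 0)
    (hu : coordX v x y u + coordY v x y u = 1) :
    AffineMap.lineMap x y (coordY v x y u) = u := by
  have hu' : coordX v x y u = 1 - coordY v x y u := by linarith
  apply plane_ext <;> rw [lineMap_coord]
  · rw [frame_eq h u 0, hu']; ring
  · rw [frame_eq h u 1, hu']; ring

lemma collinear_of_det3 {a b c : Plane} (hab : a ≠ b) (h : det3 a b c = 0) :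
    Collinear ℝ ({a, b, c} : Set Plane) := by
  have hd : (b 0 - a 0) ^ 2 + (b 1 - a 1) ^ 2 ≠ 0 := by
    intro h0
    apply hab
    have h1 : b 0 - a 0 = 0 := by nlinarith [sq_nonneg (b 0 - a 0), sq_nonneg (b 1 - a 1)]
    have h2 : b 1 - a 1 = 0 := by nlinarith [sq_nonneg (b 0 - a 0), sq_nonneg (b 1 - a 1)]
    exact plane_ext (by linarith) (by linarith)
  rw [collinear_iff_of_mem (p₀ := a) (by simp)]
  refine ⟨b - a, ?_⟩
  intro p hp
  simp only [Set.mem_insert_iff, Set.mem_singleton_iff] at hp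
  rcases hp with rfl | rfl | rfl
  · exact ⟨0, by simp⟩
  · exact ⟨1, by simp⟩
  -- The coefficient of the orthogonal projection of `p - a` to the direction `b - a`.
  · refine ⟨((p 0 - a 0) * (b 0 - a 0) + (p 1 - a 1) * (b 1 - a 1)) /
      ((b 0 - a 0) ^ 2 + (b 1 - a 1) ^ 2), ?_⟩
    unfold det3 at h
    apply plane_ext <;> simp <;> field_simp
    · linear_combination (-(b 1 - a 1)) * h
    · linear_combination (b 0 - a 0) * h

/-! ### General position, segments and angular order -/

variable {P : Finset Plane}

lemma GeneralPosition.det3_ne_zero (hP : GeneralPosition P) {a b c : P} (hab : a ≠ b) (hac : a ≠ c)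
    (hbc : b ≠ c) : det3 (a : Plane) b c ≠ 0 := fun h =>
  hP a a.2 b b.2 c c.2 (Subtype.coe_ne_coe.2 hab) (Subtype.coe_ne_coe.2 hac)
    (Subtype.coe_ne_coe.2 hbc) (collinear_of_det3 (Subtype.coe_ne_coe.2 hab) h)

/-- A point of `P` on the line through two others is one of them. -/
lemma GeneralPosition.eq_or_eq (hP : GeneralPosition P) {a b e : P} (hab : a ≠ b)
    (h : det3 (a : Plane) b e = 0) : e = a ∨ e = b := by
  by_contra hc
  push Not at hc
  exact hP.det3_ne_zero hab hc.1.symm hc.2.symm h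

lemma det3_eq_zero_of_mem_segment {a b x : Plane} (h : x ∈ segment ℝ a b) : det3 a b x = 0 := by
  obtain ⟨t, -, -, rfl⟩ := mem_segment_iff.1 h
  rw [(isAff_det3 a b).lineMap]; simp

lemma GeneralPosition.eq_or_eq_of_mem_segment (hP : GeneralPosition P) {a b e : P} (hab : a ≠ b)
    (h : (e : Plane) ∈ segment ℝ (a : Plane) b) : e = a ∨ e = b :=
  hP.eq_or_eq hab (det3_eq_zero_of_mem_segment h)

lemma lineMap_mem_segment (a b : Plane) {t : ℝ} (h0 : 0 ≤ t) (h1 : t ≤ 1) :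
    (AffineMap.lineMap a b t : Plane) ∈ segment ℝ a b :=
  mem_segment_iff.2 ⟨t, h0, h1, rfl⟩

/-- On the way from a point of a segment to one of its endpoints one stays in the segment. -/
lemma lineMap_mem_segment_of_mem {a b u : Plane} (hu : u ∈ segment ℝ a b) {t : ℝ} (h0 : 0 ≤ t)
    (h1 : t ≤ 1) : (AffineMap.lineMap u a t : Plane) ∈ segment ℝ a b :=
  (convex_segment a b).segment_subset hu (left_mem_segment ℝ a b) (lineMap_mem_segment u a h0 h1)

/-- An affine function with a zero inside a segment has opposite signs at its endpoints. -/
lemma IsAff.exists_pos_of_mem_openSegment {f : Plane → ℝ} (hf : IsAff f) {r s u : Plane}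
    (hu : u ∈ openSegment ℝ r s) (h : f u = 0) (hr : f r ≠ 0) : 0 < f r ∨ 0 < f s := by
  obtain ⟨t, h0, h1, rfl⟩ := mem_openSegment_iff.1 hu
  rw [hf.lineMap] at h
  by_contra hc
  push Not at hc
  have : f r < 0 := lt_of_le_of_ne hc.1 hr
  nlinarith

/-- A finite nonempty set of points in an open half-plane bounded by a line through `v` has a
clockwise-most element as seen from `v`. -/
lemma exists_first {ι : Type*} (S : Finset ι) (hS : S.Nonempty) (pt : ι → Plane) {g : Plane → ℝ}
    (hg : IsAff g) (v : Plane) (h : ∀ c ∈ S, g v < g (pt c)) :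
    ∃ c ∈ S, ∀ c' ∈ S, 0 ≤ det3 v (pt c) (pt c') := by
  obtain ⟨α, β, γ, e⟩ := hg
  -- The vector `(-γ, β)` is the gradient of `g` turned left by a quarter. The position along it,
  -- divided by the height above the line, increases counterclockwise around `v`.
  let k : ι → ℝ := fun c => (-γ * (pt c 0 - v 0) + β * (pt c 1 - v 1)) / (g (pt c) - g v)
  obtain ⟨c, hc, hmin⟩ := S.exists_min_image k hS
  refine ⟨c, hc, fun c' hc' => ?_⟩
  have h1 : 0 < g (pt c) - g v := sub_pos.2 (h c hc)
  have h2 : 0 < g (pt c') - g v := sub_pos.2 (h c' hc')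
  have := hmin c' hc'
  simp only [k] at this
  rw [div_le_div_iff₀ h1 h2] at this
  have hn : 0 < β ^ 2 + γ ^ 2 := by
    rcases (add_nonneg (sq_nonneg β) (sq_nonneg γ)).lt_or_eq with h | h
    · exact h
    · have hβ : β = 0 := by nlinarith [sq_nonneg β, sq_nonneg γ]
      have hγ : γ = 0 := by nlinarith [sq_nonneg β, sq_nonneg γ]
      rw [e, e, hβ, hγ] at h1
      simp at h1
  have key : (β ^ 2 + γ ^ 2) * det3 v (pt c) (pt c') =
      (-γ * (pt c' 0 - v 0) + β * (pt c' 1 - v 1)) * (g (pt c) - g v) -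
      (-γ * (pt c 0 - v 0) + β * (pt c 1 - v 1)) * (g (pt c') - g v) := by
    rw [e, e, e]; unfold det3; ring
  exact nonneg_of_mul_nonneg_right (by rw [key]; linarith) hn

/-! ### Neighbours in a full triangulation -/

variable {T : SimpleGraph P}

lemma IsPlane.inter (hT : IsPlane T) {p q r s : P} (hpq : T.Adj p q) (hrs : T.Adj r s) {y : Plane}
    (h1 : y ∈ segment ℝ (p : Plane) q) (h2 : y ∈ segment ℝ (r : Plane) s) :
    s(p, q) = s(r, s) ∨ ∃ e : P, (e = p ∨ e = q) ∧ (e = r ∨ e = s) ∧ y = e := by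
  by_cases h : s(p, q) = s(r, s)
  · exact Or.inl h
  · right
    obtain ⟨e, he1, he2, he3⟩ := hT s(p, q) hpq s(r, s) hrs h y ⟨h1, h2⟩
    exact ⟨e, Sym2.mem_iff.1 he1, Sym2.mem_iff.1 he2, he3⟩

/-- Two points that are not joined by an edge of a full triangulation are separated by an edge. -/
lemma IsFullTriangulation.exists_crossing (hP : GeneralPosition P) (hT : IsFullTriangulation T)
    {p q : P} (hne : p ≠ q) (hpq : ¬ T.Adj p q) :
    ∃ r s : P, T.Adj r s ∧ r ≠ p ∧ r ≠ q ∧ s ≠ p ∧ s ≠ q ∧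
      ∃ u, u ∈ openSegment ℝ (p : Plane) q ∧ u ∈ openSegment ℝ (r : Plane) s := by
  by_contra hc
  -- an edge meets the segment `pq` in common endpoints only
  have key : ∀ r s : P, T.Adj r s → ∀ x ∈ segment ℝ (p : Plane) q, x ∈ segment ℝ (r : Plane) s →
      ∃ e : P, (e = p ∨ e = q) ∧ (e = r ∨ e = s) ∧ x = e := by
    intro r s hrs x hx1 hx2
    by_contra hx
    push Not at hx
    have hxp : x ≠ p := by
      rintro rfl
      exact hx p (Or.inl rfl) (hP.eq_or_eq_of_mem_segment hrs.ne hx2) rfl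
    have hxq : x ≠ q := by
      rintro rfl
      exact hx q (Or.inr rfl) (hP.eq_or_eq_of_mem_segment hrs.ne hx2) rfl
    have hxr : x ≠ r := by
      rintro rfl
      exact hx r (hP.eq_or_eq_of_mem_segment hne hx1) (Or.inl rfl) rfl
    have hxs : x ≠ s := by
      rintro rfl
      exact hx s (hP.eq_or_eq_of_mem_segment hne hx1) (Or.inr rfl) rfl
    have ho1 := mem_openSegment_of_ne_left_right hxp.symm hxq.symm hx1
    have ho2 := mem_openSegment_of_ne_left_right hxr.symm hxs.symm hx2
    have d1 := det3_eq_zero_of_mem_segment hx1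
    -- if an endpoint is shared then both segments lie on one line
    have aux : ∀ a b c : P, a ≠ b → a ≠ c → x ≠ a → x ∈ segment ℝ (a : Plane) b →
        x ∈ segment ℝ (a : Plane) c → b = c := by
      intro a b c hab hac hxa h1 h2
      obtain ⟨t, -, -, rfl⟩ := mem_segment_iff.1 h1
      have ht : t ≠ 0 := by rintro rfl; simp at hxa
      have := det3_eq_zero_of_mem_segment h2
      rw [(isAff_det3 (a : Plane) c).lineMap] at this
      simp only [det3_self_outer, mul_zero, zero_add, mul_eq_zero, ht, false_or] at this
      rcases hP.eq_or_eq hac this with h | h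
      · exact absurd h.symm hab
      · exact h
    have adj_of : ∀ a b : P, s(r, s) = s(a, b) → T.Adj a b := by
      intro a b h
      have : s(r, s) ∈ T.edgeSet := hrs
      rw [h] at this; exact this
    have sx2 : x ∈ segment ℝ (s : Plane) r := by rwa [segment_symm]
    have sx1 : x ∈ segment ℝ (q : Plane) p := by rwa [segment_symm]
    refine hc ⟨r, s, hrs, ?_, ?_, ?_, ?_, x, ho1, ho2⟩
    · rintro rfl
      obtain rfl := aux r s q hrs.ne hne hxr hx2 hx1
      exact hpq hrs
    · rintro rfl
      obtain rfl := aux r s p hrs.ne hne.symm hxr hx2 sx1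
      exact hpq hrs.symm
    · rintro rfl
      obtain rfl := aux s r q hrs.ne' hne hxs sx2 hx1
      exact hpq hrs.symm
    · rintro rfl
      obtain rfl := aux s r p hrs.ne' hne.symm hxs sx2 sx1
      exact hpq hrs
  -- By `key`, adding `pq` keeps the graph plane, so maximality puts `pq` into `T`.
  have hle : T ⊔ SimpleGraph.edge p q ≤ T := by
    refine hT.le_of_ge ?_ le_sup_left
    have hmem : ∀ e, e ∈ (T ⊔ SimpleGraph.edge p q).edgeSet → e ∈ T.edgeSet ∨ e = s(p, q) := by
      intro e he
      rw [SimpleGraph.edgeSet_sup] at he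
      rcases he with he | he
      · exact Or.inl he
      · rw [SimpleGraph.edgeSet_edge_of_ne hne] at he
        exact Or.inr he
    intro e he f hf hef x hx
    rcases hmem e he with he | rfl <;> rcases hmem f hf with hf | rfl
    · exact hT.prop e he f hf hef x hx
    · induction e with
      | h r s =>
        obtain ⟨e, h1, h2, h3⟩ := key r s he x hx.2 hx.1
        exact ⟨e, Sym2.mem_iff.2 h2, Sym2.mem_iff.2 h1, h3⟩
    · induction f with
      | h r s =>
        obtain ⟨e, h1, h2, h3⟩ := key r s hf x hx.1 hx.2
        exact ⟨e, Sym2.mem_iff.2 h1, Sym2.mem_iff.2 h2, h3⟩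
    · exact absurd rfl hef
  exact hpq (hle (Or.inr (by rw [SimpleGraph.edge_adj]; exact ⟨Or.inl ⟨rfl, rfl⟩, hne⟩)))

set_option maxHeartbeats 1000000 in
/-- A vertex of a full triangulation with a point of `P` in an open half-plane bounded by a line
through it has a neighbour in that half-plane. -/
lemma IsFullTriangulation.exists_adj_gt (hP : GeneralPosition P) (hT : IsFullTriangulation T)
    {g : Plane → ℝ} (hg : IsAff g) {v w : P} (hvw : g v < g w) :
    ∃ z : P, T.Adj v z ∧ g v < g z := by
  by_contra none
  have hne : v ≠ w := by rintro rfl; exact lt_irrefl _ hvw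
  have hnadj : ¬ T.Adj v w := fun h => none ⟨w, h, hvw⟩
  -- The parameters at which `vw` meets an edge not incident with `v`. The set is compact, so there
  -- is a first crossing.
  let K : Set ℝ := Set.Icc 0 1 ∩ {t | (AffineMap.lineMap (v : Plane) (w : Plane) t : Plane) ∈
    ⋃ e : {e : P × P // T.Adj e.1 e.2 ∧ e.1 ≠ v ∧ e.2 ≠ v},
      segment ℝ (e.1.1 : Plane) (e.1.2 : Plane)}
  have hK : IsCompact K := by
    refine isCompact_Icc.inter_right ?_
    refine IsClosed.preimage AffineMap.lineMap_continuous ?_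
    refine isClosed_iUnion_of_finite fun e => ?_
    rw [segment_eq_image_lineMap]
    exact (isCompact_Icc.image AffineMap.lineMap_continuous).isClosed
  have memK : ∀ t : ℝ, 0 ≤ t → t ≤ 1 → ∀ r s : P, T.Adj r s → r ≠ v → s ≠ v →
      (AffineMap.lineMap (v : Plane) (w : Plane) t : Plane) ∈ segment ℝ (r : Plane) s → t ∈ K := by
    intro t h0 h1 r s hrs hr hs h
    exact ⟨⟨h0, h1⟩, Set.mem_iUnion.2 ⟨⟨(r, s), hrs, hr, hs⟩, h⟩⟩
  obtain ⟨r, s, hrs, hrv, hrw, hsv, hsw, u, hu1, hu2⟩ := hT.exists_crossing hP hne hnadj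
  obtain ⟨t1, ht10, ht11, rfl⟩ := mem_openSegment_iff.1 hu1
  have ht1K := memK t1 ht10.le ht11.le r s hrs hrv hsv (openSegment_subset_segment _ _ _ hu2)
  obtain ⟨t0, ⟨⟨h0, h1⟩, ht0⟩, hmin⟩ := hK.exists_isLeast ⟨t1, ht1K⟩
  have h1 : t0 < 1 := lt_of_le_of_lt (hmin ht1K) ht11
  clear hrs hrv hrw hsv hsw hu1 hu2 ht1K ht10 ht11
  clear r s t1
  simp only [Set.mem_ofPred_eq] at ht0
  obtain ⟨⟨⟨p, q⟩, hpq, hpv, hqv⟩, hx⟩ := Set.mem_iUnion.1 ht0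
  simp only at hpq hpv hqv hx
  clear ht0
  obtain ⟨x, hxdef⟩ : ∃ x : Plane, x = AffineMap.lineMap (v : Plane) (w : Plane) t0 := ⟨_, rfl⟩
  rw [← hxdef] at hx
  have hpos : 0 < t0 := by
    rcases h0.lt_or_eq with h | h
    · exact h
    · subst h
      rw [AffineMap.lineMap_apply_zero] at hxdef
      subst hxdef
      rcases hP.eq_or_eq_of_mem_segment hpq.ne hx with h | h
      · exact absurd h.symm hpv
      · exact absurd h.symm hqv
  -- the first crossing point is not a point of `P`
  have xP : ∀ e : P, x ≠ e := by
    rintro e he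
    have : det3 (v : Plane) w e = 0 := by
      rw [← he, hxdef, (isAff_det3 _ _).lineMap]; simp
    rcases hP.eq_or_eq hne this with rfl | rfl
    · apply hpos.ne'
      have h' := congrArg g (hxdef.symm.trans he)
      rw [hg.lineMap] at h'
      have : t0 * (g w - g e) = 0 := by linarith
      rcases mul_eq_zero.1 this with h | h
      · exact h
      · linarith
    · apply h1.ne
      have h' := congrArg g (hxdef.symm.trans he)
      rw [hg.lineMap] at h'
      have : (1 - t0) * (g e - g v) = 0 := by linarith
      rcases mul_eq_zero.1 this with h | h <;> linarith
  have hgx : g v < g x := by rw [hxdef, hg.lineMap]; nlinarith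
  -- With this orientation of the crossed edge, the triangle `vxq` lies in the half-plane above `g
  -- v`, except for the corner `v`.
  obtain ⟨p, q, hpq, hpv, hqv, hx, hgq⟩ : ∃ p q : P, T.Adj p q ∧ p ≠ v ∧ q ≠ v ∧
      x ∈ segment ℝ (p : Plane) q ∧ g x ≤ g q := by
    by_cases h : g x ≤ g q
    · exact ⟨p, q, hpq, hpv, hqv, hx, h⟩
    · refine ⟨q, p, hpq.symm, hqv, hpv, by rwa [segment_symm], ?_⟩
      obtain ⟨t, a0, a1, e⟩ := mem_segment_iff.1 hx
      have := hg.lineMap (p : Plane) q t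
      rw [e] at this
      push Not at h
      rcases a1.lt_or_eq with a1 | rfl
      · nlinarith
      · linarith
  obtain ⟨σ, hσ0, hσ1, hσ⟩ := mem_segment_iff.1 hx
  have hσ1 : σ < 1 := lt_of_le_of_ne hσ1 (by
    rintro rfl; rw [AffineMap.lineMap_apply_one] at hσ; exact xP q hσ.symm)
  have hσ0 : 0 < σ := lt_of_le_of_ne hσ0 (by
    rintro rfl; rw [AffineMap.lineMap_apply_zero] at hσ; exact xP p hσ.symm)
  have hqw : q ≠ w := by
    rintro rfl
    exact none ⟨p, by
      have e1 : det3 (v : Plane) q x = 0 := by rw [hxdef, (isAff_det3 _ _).lineMap]; simp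
      rw [← hσ, (isAff_det3 _ _).lineMap] at e1
      simp only [det3_self_right, mul_zero, add_zero, mul_eq_zero] at e1
      rcases e1 with e1 | e1
      · linarith
      · rcases hP.eq_or_eq hne e1 with rfl | rfl
        · exact absurd rfl hpv
        · exact absurd rfl hpq.ne⟩
  have hΔ : det3 (v : Plane) x q ≠ 0 := by
    have e : det3 (v : Plane) x q = t0 * det3 (v : Plane) w q := by
      rw [← det3_rotate, ← det3_rotate, hxdef, (isAff_det3 _ _).lineMap, ← det3_rotate (v : Plane) w]
      rw [← det3_rotate (w : Plane)]; simp
    rw [e]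
    exact mul_ne_zero hpos.ne' (hP.det3_ne_zero hne hqv.symm hqw.symm)
  let X : Plane → ℝ := coordX v x q
  let Y : Plane → ℝ := coordY v x q
  have aX : IsAff X := isAff_coordX _ _ _
  have aY : IsAff Y := isAff_coordY _ _ _
  let U : Plane → ℝ := fun u => 1 - (X u + Y u)
  have aU : IsAff U := (isAff_const 1).sub (aX.add aY)
  have Xv : X v = 0 := coordX_self _ _ _
  have Yv : Y v = 0 := coordY_self _ _ _
  have Xx : X x = 1 := coordX_left hΔ
  have Yx : Y x = 0 := coordY_left _ _ _
  have Xq : X q = 0 := coordX_right _ _ _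
  have Yq : Y q = 1 := coordY_right hΔ
  -- points on the axis through `x`
  have onX : ∀ u, Y u = 0 → AffineMap.lineMap (v : Plane) (w : Plane) (t0 * X u) = u := by
    intro u hu
    have e := eq_lineMap_of_coordY_eq_zero hΔ hu
    apply plane_ext <;> rw [lineMap_coord, ← e, lineMap_coord, hxdef, lineMap_coord, ← hxdef] <;>
      simp only [X, e] <;> ring
  let Z : Finset P := {z | z ≠ v ∧ 0 ≤ X z ∧ 0 ≤ Y z ∧ X z + Y z ≤ 1}
  have memZ : ∀ z, z ∈ Z ↔ z ≠ v ∧ 0 ≤ X z ∧ 0 ≤ Y z ∧ X z + Y z ≤ 1 := by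
    intro z; simp [Z]
  have hqZ : q ∈ Z := (memZ q).2 ⟨hqv, by rw [Xq], by rw [Yq]; norm_num, by rw [Xq, Yq]; norm_num⟩
  have Ypos : ∀ z ∈ Z, 0 < Y z := by
    intro z hz
    obtain ⟨z1, z2, z3, z4⟩ := (memZ z).1 hz
    refine lt_of_le_of_ne z3 fun h0 => ?_
    have e := onX z h0.symm
    have d : det3 (v : Plane) w z = 0 := by rw [← e, (isAff_det3 _ _).lineMap]; simp
    rcases hP.eq_or_eq hne d with h | h
    · exact z1 h
    · have h' := congrArg g e
      rw [hg.lineMap, h] at h'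
      have : (1 - t0 * X z) * (g w - g v) = 0 := by rw [h]; linarith
      rcases mul_eq_zero.1 this with h | h
      · nlinarith
      · linarith
  -- Among the points of `P` in the closed triangle `vxq` other than `v`, the one seen from `v`
  -- nearest to the ray `vx`. The function `k` below is positive on the side of the line `vz`
  -- containing `x`.
  obtain ⟨z, hz, hzmin⟩ := Z.exists_min_image (fun z : P => Y z / (X z + Y z)) ⟨q, hqZ⟩
  obtain ⟨z1, z2, z3, z4⟩ := (memZ z).1 hz
  have Yz := Ypos z hz
  let k : Plane → ℝ := fun r => Y z * X r - X z * Y r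
  have ak : IsAff k := (aX.const_mul _).sub (aY.const_mul _)
  have kmin : ∀ z' ∈ Z, k z' ≤ 0 := by
    intro z' hz'
    have hY' := Ypos z' hz'
    have hX' := ((memZ z').1 hz').2.1
    have := hzmin z' hz'
    rw [div_le_div_iff₀ (by linarith) (by linarith)] at this
    simp only [k]; nlinarith
  have hgz : g v < g z := by
    rw [hg.frame hΔ z]
    have : 0 < Y z * (g q - g v) := mul_pos Yz (by linarith)
    have : 0 ≤ X z * (g x - g v) := mul_nonneg z2 (by linarith)
    simp only [X, Y] at *
    linarith
  have hvz : ¬ T.Adj v z := fun h => none ⟨z, h, hgz⟩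
  obtain ⟨r, s, hrs, hrv, hrz, hsv, hsz, u, hu1, hu2⟩ := hT.exists_crossing hP z1.symm hvz
  obtain ⟨μ, hμ0, hμ1, hμ⟩ := mem_openSegment_iff.1 hu1
  have ku : k u = 0 := by
    rw [← hμ, ak.lineMap]; simp only [k, Xv, Yv]; ring
  have kne : ∀ r : P, r ≠ v → r ≠ z → k r ≠ 0 := by
    intro r hrv hrz h
    apply hP.det3_ne_zero z1.symm hrv.symm hrz.symm
    have hz0 := frame_eq hΔ z 0
    have hz1 := frame_eq hΔ z 1
    have hr0 := frame_eq hΔ r 0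
    have hr1 := frame_eq hΔ r 1
    have : det3 (v : Plane) z r = - det3 (v : Plane) x q * k r := by
      simp only [det3, k, X, Y]
      rw [hz0, hz1, hr0, hr1]
      ring
    rw [this, h, mul_zero]
  obtain ⟨r, s, hrs, hrv, hsv, hrz, hsz, hu2, kr⟩ : ∃ r s : P, T.Adj r s ∧ r ≠ v ∧ s ≠ v ∧ r ≠ z ∧
      s ≠ z ∧ u ∈ segment ℝ (r : Plane) s ∧ 0 < k r := by
    have hseg := openSegment_subset_segment _ _ _ hu2
    rcases ak.exists_pos_of_mem_openSegment hu2 ku (kne r hrv hrz) with h | h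
    · exact ⟨r, s, hrs, hrv, hsv, hrz, hsz, hseg, h⟩
    · exact ⟨s, r, hrs.symm, hsv, hrv, hsz, hrz, by rwa [segment_symm], h⟩
  have Yu : 0 < Y u := by rw [← hμ, aY.lineMap, Yv]; nlinarith
  have Uu : 0 < U u := by
    rw [← hμ, aU.lineMap]; simp only [U, Xv, Yv]; nlinarith
  have Up : U p = 0 := by
    have : U x = 0 := by simp only [U, Xx, Yx]; ring
    rw [← hσ, aU.lineMap] at this
    simp only [U, Xq, Yq] at this ⊢
    have h2 : (1 - σ) * (1 - (X p + Y p)) = 0 := by linarith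
    rcases mul_eq_zero.1 h2 with h | h
    · linarith
    · exact h
  have Uq : U q = 0 := by simp only [U, Xq, Yq]; ring
  have Yp : Y p < 0 := by
    have : Y x = 0 := Yx
    rw [← hσ, aY.lineMap, Yq] at this
    nlinarith
  have hneq : s(r, s) ≠ s(p, q) := by
    intro h
    have hu : u ∈ edgeSegment s(p, q) := by rw [← h]; exact hu2
    obtain ⟨t, -, -, e⟩ := mem_segment_iff.1 (show u ∈ segment ℝ (p : Plane) q from hu)
    rw [← e, aU.lineMap, Up, Uq] at Uu
    simp at Uu
  -- If `r` is in the triangle, the choice of `z` is contradicted. Otherwise the way from `u` to `r`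
  -- leaves through `vx`, against the choice of the first crossing (or, at `x` itself, against
  -- planarity), or through `xq`, where planarity leaves only `p` and `q`, both on the wrong side.
  by_cases hr : 0 < Y r ∧ 0 < U r
  · have hXr : 0 < X r := by
      have h1 : 0 ≤ X z * Y r := mul_nonneg z2 hr.1.le
      have h2 : 0 < Y z * X r := by simp only [k] at kr; linarith
      exact pos_of_mul_pos_right h2 Yz.le
    have : r ∈ Z := (memZ r).2 ⟨hrv, hXr.le, hr.1.le, by have := hr.2; simp only [U] at this; linarith⟩
    linarith [kmin r this]
  · obtain ⟨θ, hθ0, hθ1, e1, e2, -, e3⟩ := exists_exit aY aU aU Yu Uu Uu (r := r)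
      (fun h => hr ⟨h.1, h.2.1⟩)
    have hy := lineMap_mem_segment_of_mem hu2 hθ0.le hθ1
    have ky := ak.lineMap u r θ
    rw [ku] at ky
    generalize (AffineMap.lineMap u (r : Plane) θ : Plane) = y at e1 e2 e3 hy ky
    have ky : 0 < k y := by rw [ky]; nlinarith
    have Xy : 0 < X y := by
      have h1 : 0 ≤ X z * Y y := mul_nonneg z2 e1
      have h2 : 0 < Y z * X y := by simp only [k] at ky; linarith
      exact pos_of_mul_pos_right h2 Yz.le
    have case : Y y = 0 ∨ U y = 0 := by tauto
    rcases case with h | h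
    · have e := onX y h
      have hX1 : X y ≤ 1 := by simp only [U] at e2; linarith
      have := hmin (memK (t0 * X y) (by positivity) (by nlinarith) r s hrs hrv hsv (by rwa [e]))
      have hX : X y = 1 := by
        by_contra hc
        have : X y < 1 := lt_of_le_of_ne hX1 hc
        nlinarith
      rw [hX, mul_one, ← hxdef] at e
      subst e
      rcases hT.prop.inter hrs hpq hy hx with h | ⟨e, -, -, h⟩
      · exact hneq h
      · exact xP e h
    · have e := eq_lineMap_of_coord_sum hΔ (u := y) (by simp only [U, X, Y] at h; linarith)
      have hY1 : Y y ≤ 1 := by simp only [U] at h; linarith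
      have hyx : y ∈ segment ℝ x q := mem_segment_iff.2 ⟨Y y, e1, hY1, e⟩
      have hyp : y ∈ segment ℝ (p : Plane) q :=
        (convex_segment _ _).segment_subset hx (right_mem_segment ℝ _ _) hyx
      rcases hT.prop.inter hrs hpq hy hyp with h | ⟨e, -, h1 | h1, h2⟩
      · exact hneq h
      · rw [h2, h1] at e1; linarith
      · have := kmin q hqZ
        rw [h2, h1] at ky; linarith

/-! ### Faces -/

/-- `abc` is a counterclockwise triangle of edges of `T` without points of `P` inside. -/
structure IsFace (T : SimpleGraph P) (a b c : P) : Prop where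
  ab : T.Adj a b
  bc : T.Adj b c
  ca : T.Adj c a
  pos : 0 < det3 (a : Plane) b c
  empty : ∀ p : P, ¬ (0 < det3 (a : Plane) b p ∧ 0 < det3 (b : Plane) c p ∧
    0 < det3 (c : Plane) a p)

lemma IsFace.rotate {a b c : P} (h : IsFace T a b c) : IsFace T b c a :=
  ⟨h.bc, h.ca, h.ab, by rw [det3_rotate]; exact h.pos,
    fun p hp => h.empty p ⟨hp.2.2, hp.1, hp.2.1⟩⟩

/-- The last two areas are the barycentric weights of `y` on the line `ab`. This places the points
supplied by `exists_exit` on sides of a triangle. -/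
lemma mem_segment_of_det3 {a b c y : Plane} (h : 0 < det3 a b c) (h0 : det3 a b y = 0)
    (h1 : 0 ≤ det3 b c y) (h2 : 0 ≤ det3 c a y) : y ∈ segment ℝ a b := by
  have hc : det3 b c y + det3 c a y = det3 a b c := by
    have : det3 a b y + det3 b c y + det3 c a y = det3 a b c := by unfold det3; ring
    linarith
  refine mem_segment_iff.2 ⟨det3 c a y / det3 a b c, by positivity, ?_, ?_⟩
  · rw [div_le_one h]; linarith
  · have hX : coordX a b c y = det3 c a y / det3 a b c := by
      rw [coordX, ← det3_rotate a y c, ← det3_rotate y c a]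
    rw [← hX]
    exact eq_lineMap_of_coordY_eq_zero h.ne' (by rw [coordY, h0, zero_div])

/-- No edge meets the interior of a face. -/
lemma IsFace.not_mem_segment (hT : IsPlane T) {a b c : P} (h : IsFace T a b c)
    {p q : P} (hpq : T.Adj p q) {x : Plane} (hx : x ∈ segment ℝ (p : Plane) q) :
    ¬ (0 < det3 (a : Plane) b x ∧ 0 < det3 (b : Plane) c x ∧ 0 < det3 (c : Plane) a x) := by
  rintro ⟨h1, h2, h3⟩
  have side : ∀ r s : P, s(p, q) = s(r, s) → det3 (r : Plane) s x = 0 := by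
    intro r s hrs
    have hx' : x ∈ edgeSegment s(r, s) := by rw [← hrs]; exact hx
    exact det3_eq_zero_of_mem_segment hx'
  have nab : s(p, q) ≠ s(a, b) := fun e => h1.ne' (side a b e)
  have nbc : s(p, q) ≠ s(b, c) := fun e => h2.ne' (side b c e)
  have nca : s(p, q) ≠ s(c, a) := fun e => h3.ne' (side c a e)
  -- both endpoints are vertices of the face
  have key : ∀ p q : P, T.Adj p q → x ∈ segment ℝ (p : Plane) q → s(p, q) ≠ s(a, b) →
      s(p, q) ≠ s(b, c) → s(p, q) ≠ s(c, a) → p = a ∨ p = b ∨ p = c := by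
    intro p q hpq hx nab nbc nca
    -- Since the face is empty, the way from `x` to `p` leaves it through a side; planarity then
    -- makes the exit point a corner.
    obtain ⟨t, ht0, ht1, e1, e2, e3, e4⟩ := exists_exit (isAff_det3 (a : Plane) b)
      (isAff_det3 (b : Plane) c) (isAff_det3 (c : Plane) a) h1 h2 h3 (h.empty p)
    have hy := lineMap_mem_segment_of_mem hx ht0.le ht1
    obtain ⟨y, hydef⟩ : ∃ y : Plane, y = AffineMap.lineMap x (p : Plane) t := ⟨_, rfl⟩
    rw [← hydef] at e1 e2 e3 e4 hy
    have hcorner : ∃ e : P, (e = p ∨ e = q) ∧ (e = a ∨ e = b ∨ e = c) ∧ y = e := by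
      rcases e4 with e | e | e
      · have := mem_segment_of_det3 h.pos e e2 e3
        rcases hT.inter hpq h.ab hy this with h | ⟨e, f1, f2, f3⟩
        · exact absurd h nab
        · exact ⟨e, f1, by tauto, f3⟩
      · have := mem_segment_of_det3 h.rotate.pos e e3 e1
        rcases hT.inter hpq h.bc hy this with h | ⟨e, f1, f2, f3⟩
        · exact absurd h nbc
        · exact ⟨e, f1, by tauto, f3⟩
      · have := mem_segment_of_det3 h.rotate.rotate.pos e e1 e2
        rcases hT.inter hpq h.ca hy this with h | ⟨e, f1, f2, f3⟩
        · exact absurd h nca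
        · exact ⟨e, f1, by tauto, f3⟩
    obtain ⟨e, rfl | rfl, f2, f3⟩ := hcorner
    · exact f2
    · -- `y = q` would force `x = q`
      exfalso
      have hxq : x = e := by
        obtain ⟨σ, s0, s1, hσ⟩ := mem_segment_iff.1 hx
        have hne : (p : Plane) ≠ e := Subtype.coe_ne_coe.2 hpq.ne
        have e0 : (1 - σ) * (1 - t) + t = 0 ∨ (p : Plane) = e := by
          by_contra hcon
          push Not at hcon
          apply hcon.2
          rw [hydef, ← hσ] at f3
          have c0 := congrFun (congrArg (fun z : Plane => (z : Fin 2 → ℝ)) f3) 0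
          have c1 := congrFun (congrArg (fun z : Plane => (z : Fin 2 → ℝ)) f3) 1
          simp only [lineMap_coord] at c0 c1
          apply plane_ext
          · apply mul_left_cancel₀ hcon.1; linear_combination c0
          · apply mul_left_cancel₀ hcon.1; linear_combination c1
        rcases e0 with e0 | e0
        · nlinarith [mul_nonneg (sub_nonneg.2 s1) (sub_nonneg.2 ht1)]
        · exact absurd e0 hne
      apply h.empty e
      rw [← hxq]
      exact ⟨h1, h2, h3⟩
  have hp := key p q hpq hx nab nbc nca
  have hq := key q p hpq.symm (by rwa [segment_symm]) (by rwa [Sym2.eq_swap]) (by rwa [Sym2.eq_swap])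
    (by rwa [Sym2.eq_swap])
  have := hpq.ne
  rcases hp with rfl | rfl | rfl <;> rcases hq with rfl | rfl | rfl <;>
    first
    | exact this rfl
    | exact nab rfl
    | exact nbc rfl
    | exact nca rfl
    | exact nab Sym2.eq_swap
    | exact nbc Sym2.eq_swap
    | exact nca Sym2.eq_swap

/-- No edge at a vertex of a face runs into the angle of the face. -/
lemma IsFace.not_mem_cone (hT : IsPlane T) {v x c y : P} (h : IsFace T v x c) (hy : T.Adj v y) :
    ¬ (0 < det3 (v : Plane) x y ∧ 0 < det3 (v : Plane) y c) := by
  rintro ⟨h1, h2⟩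
  have h2' : 0 < det3 (c : Plane) v y := by rwa [← det3_rotate (c : Plane) v y]
  have hpos := h.pos
  have h4 : 0 < det3 (x : Plane) c v := by rwa [det3_rotate]
  -- a point close to `v` on the edge
  obtain ⟨t, t0, t1, ht⟩ : ∃ t : ℝ, 0 < t ∧ t ≤ 1 ∧
      0 < (1 - t) * det3 (x : Plane) c v + t * det3 (x : Plane) c y := by
    -- With `d` the value at `v` and `m` the absolute value at `y`, the combination is at least `d -
    -- t * (d + m)`, which is `d / 2` for this `t`.
    refine ⟨det3 (x : Plane) c v / (2 * (det3 (x : Plane) c v + |det3 (x : Plane) c y|)), by positivity, ?_, ?_⟩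
    · rw [div_le_one (by positivity)]
      nlinarith [abs_nonneg (det3 (x : Plane) c y)]
    · have := neg_abs_le (det3 (x : Plane) c y)
      set m := |det3 (x : Plane) c y|
      set d := det3 (x : Plane) c v
      have hm : 0 ≤ m := abs_nonneg _
      have e : d / (2 * (d + m)) * (2 * (d + m)) = d := by field_simp
      set s := d / (2 * (d + m))
      have hs : 0 < s := by positivity
      nlinarith
  refine h.not_mem_segment hT hy (lineMap_mem_segment (v : Plane) y t0.le t1) ⟨?_, ?_, ?_⟩
  · rw [(isAff_det3 _ _).lineMap]; simp; positivity
  · rwa [(isAff_det3 _ _).lineMap]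
  · rw [(isAff_det3 _ _).lineMap]; simp; positivity

/-- There is at most one face to the left of an edge. -/
lemma IsFace.unique (hP : GeneralPosition P) (hT : IsPlane T) {a b c c' : P} (h : IsFace T a b c)
    (h' : IsFace T a b c') : c = c' := by
  by_contra hne
  have n1 : det3 (a : Plane) c c' ≠ 0 := hP.det3_ne_zero h.ca.ne' h'.ca.ne' hne
  -- The edge from `a` that is nearer in angle to `ab` runs into the angle of the other face.
  rcases lt_or_gt_of_ne n1 with hlt | hgt
  · exact h.not_mem_cone hT h'.ca.symm ⟨h'.pos, by rw [det3_swap']; linarith⟩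
  · exact h'.not_mem_cone hT h.ca.symm ⟨h.pos, hgt⟩

/-- There is a face to the left of every edge that has a point of `P` to its left. -/
lemma IsFullTriangulation.exists_face (hP : GeneralPosition P) (hT : IsFullTriangulation T)
    {a b w : P} (hab : T.Adj a b) (hw : 0 < det3 (a : Plane) b w) : ∃ c, IsFace T a b c := by
  classical
  have g0 : det3 (a : Plane) b a = 0 := det3_self_outer _ _
  obtain ⟨c₀, hc₀, hc₀'⟩ := hT.exists_adj_gt hP (isAff_det3 (a : Plane) b) (v := a) (w := w)
    (by rw [g0]; exact hw)
  rw [g0] at hc₀'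
  -- The third vertex is the neighbour of `a` left of `ab` that comes first in counterclockwise
  -- order after `b`.
  obtain ⟨c, hcS, hfirst⟩ := exists_first
    ({c | T.Adj a c ∧ 0 < det3 (a : Plane) b c} : Finset P) ⟨c₀, by simp [hc₀, hc₀']⟩
    (fun c : P => (c : Plane)) (isAff_det3 (a : Plane) b) a
    (fun c hc => by rw [g0]; exact ((Finset.mem_filter.1 hc).2).2)
  obtain ⟨hac, hpos⟩ := (Finset.mem_filter.1 hcS).2
  -- no edge at `a` runs between `b` and `c`
  have nocone : ∀ y : P, T.Adj a y → 0 < det3 (a : Plane) b y → 0 ≤ det3 (a : Plane) c y :=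
    fun y h1 h2 => hfirst y (by simp [h1, h2])
  have hΔ : det3 (a : Plane) b c ≠ 0 := hpos.ne'
  let X : Plane → ℝ := det3 (c : Plane) a
  let Y : Plane → ℝ := det3 (a : Plane) b
  let U : Plane → ℝ := det3 (b : Plane) c
  have aX : IsAff X := isAff_det3 _ _
  have aY : IsAff Y := isAff_det3 _ _
  have aU : IsAff U := isAff_det3 _ _
  have Xa : X a = 0 := by simp [X]
  have Ya : Y a = 0 := by simp [Y]
  have Ua : U a = det3 (a : Plane) b c := by simp [U, det3_rotate]
  have hXY : ∀ u, U u = det3 (a : Plane) b c - (X u + Y u) := by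
    intro u; simp only [U, X, Y, det3]; ring
  -- an edge point inside the open angle at `a` near side moves to an endpoint in the triangle
  have push : ∀ r s : P, T.Adj r s → ∀ u ∈ segment ℝ (r : Plane) s, 0 < X u → 0 < Y u →
      (∀ t : ℝ, 0 < t → t ≤ 1 → 0 < (1 - t) * U u + t * U r) → r ≠ a → s ≠ a → 0 < X r ∧ 0 < Y r := by
    intro r s hrs u hu hX hY hUr hra hsa
    by_contra hcon
    -- Leaving the angle where `U` is positive means meeting the edge `ab` or `ca`. Planarity allows
    -- this only at a corner, but `U` vanishes at `b` and `c`, and `a` is not an endpoint of `rs`.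
    obtain ⟨t, t0, t1, e1, e2, -, e4⟩ := exists_exit aX aY aY hX hY hY (r := r)
      (fun h => hcon ⟨h.1, h.2.1⟩)
    have hy := lineMap_mem_segment_of_mem hu t0.le t1
    have hUy := aU.lineMap u r t
    generalize (AffineMap.lineMap u (r : Plane) t : Plane) = y at e1 e2 e4 hy hUy
    have hUy : 0 < U y := by rw [hUy]; exact hUr t t0 t1
    have endp : ∀ e : P, (e = r ∨ e = s) → e = a → False := by
      rintro e (rfl | rfl) h
      · exact hra h
      · exact hsa h
    have off : ∀ p : P, T.Adj a p → s(r, s) ≠ s(a, p) := by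
      intro p hp h
      have : a ∈ s(r, s) := by rw [h]; exact Sym2.mem_mk_left a p
      rcases Sym2.mem_iff.1 this with h | h
      · exact hra h.symm
      · exact hsa h.symm
    have e4 : X y = 0 ∨ Y y = 0 := by tauto
    rcases e4 with e | e
    · have hys : y ∈ segment ℝ (c : Plane) a := by
        refine mem_segment_of_det3 (c := (b : Plane)) ?_ e e2 hUy.le
        rwa [← det3_rotate (c : Plane) a b]
      rcases hT.prop.inter hrs hac.symm hy hys with h | ⟨e, f1, rfl | f2, f3⟩
      · exact off c hac (h.trans Sym2.eq_swap)
      · rw [f3] at hUy; simp [U] at hUy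
      · exact endp e f1 f2
    · have hys : y ∈ segment ℝ (a : Plane) b := mem_segment_of_det3 hpos e hUy.le e1
      rcases hT.prop.inter hrs hab hy hys with h | ⟨e, f1, f2 | rfl, f3⟩
      · exact off b hab h
      · exact endp e f1 f2
      · rw [f3] at hUy; simp [U] at hUy
  -- the ray of an edge at `a` avoids the open angle
  have ray : ∀ y : P, T.Adj a y → ∀ u, 0 < X u → 0 < Y u → 0 ≤ U u → u ∈ segment ℝ (a : Plane) y →
      False := by
    intro y hay u hX hY hU hu
    obtain ⟨t, t0, t1, rfl⟩ := mem_segment_iff.1 hu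
    rw [aX.lineMap, Xa] at hX
    rw [aY.lineMap, Ya] at hY
    have h1 : 0 < X y := by
      rcases t0.lt_or_eq with h | rfl
      · by_contra hc; push Not at hc; nlinarith
      · simp at hX
    have h2 : 0 < Y y := by
      rcases t0.lt_or_eq with h | rfl
      · by_contra hc; push Not at hc; nlinarith
      · simp at hX
    have := nocone y hay h2
    rw [det3_swap] at this
    simp only [X] at h1
    linarith
  have noP : ∀ p : P, ¬ (0 < Y p ∧ 0 < U p ∧ 0 < X p) := by
    intro p hp
    -- The point in the triangle farthest from `bc`. As `az` is not an edge, some edge crosses it,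
    -- and by `push` one end of that edge is in the triangle and still farther from `bc`.
    obtain ⟨z, hz, hzmax⟩ := Finset.exists_max_image
      ({z | 0 < Y z ∧ 0 < U z ∧ 0 < X z} : Finset P) (fun z => U z) ⟨p, by simp [hp]⟩
    obtain ⟨z1, z2, z3⟩ := (Finset.mem_filter.1 hz).2
    have hza : a ≠ z := by rintro rfl; rw [Ya] at z1; exact lt_irrefl _ z1
    have hnaz : ¬ T.Adj a z := fun h => ray z h z z3 z1 z2.le (right_mem_segment ℝ _ _)
    obtain ⟨r, s, hrs, hra, hrz, hsa, hsz, u, hu1, hu2⟩ := hT.exists_crossing hP hza hnaz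
    have hus := openSegment_subset_segment _ _ _ hu2
    obtain ⟨t, t0, t1, rfl⟩ := mem_openSegment_iff.1 hu1
    have uX : 0 < X (AffineMap.lineMap (a : Plane) (z : Plane) t) := by
      rw [aX.lineMap, Xa]; nlinarith
    have uY : 0 < Y (AffineMap.lineMap (a : Plane) (z : Plane) t) := by
      rw [aY.lineMap, Ya]; nlinarith
    have uU : U z < U (AffineMap.lineMap (a : Plane) (z : Plane) t) := by
      have : U z < U a := by
        have := hXY z
        rw [Ua]; linarith
      rw [aU.lineMap]; nlinarith
    generalize (AffineMap.lineMap (a : Plane) (z : Plane) t : Plane) = u at *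
    have fin : ∀ r s : P, T.Adj r s → r ≠ a → s ≠ a → u ∈ segment ℝ (r : Plane) s → U u ≤ U r → False := by
      intro r s hrs hra hsa hu hUr
      have hUu : 0 < U u := z2.trans uU
      obtain ⟨h1, h2⟩ := push r s hrs u hu uX uY (fun t t0 t1 => by nlinarith) hra hsa
      have := hzmax r (by simp [h1, h2, hUu.trans_le hUr])
      linarith
    obtain ⟨σ, s0, s1, hσ⟩ := mem_openSegment_iff.1 hu2
    have hUσ := aU.lineMap (r : Plane) s σ
    rw [hσ] at hUσ
    rcases le_total (U u) (U r) with h | h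
    · exact fin r s hrs hra hsa hus h
    · refine fin s r hrs.symm hsa hra (by rwa [segment_symm]) ?_
      by_contra hc
      push Not at hc
      nlinarith
  have hbc' : b ≠ c := by rintro rfl; simp at hpos
  refine ⟨c, hab, ?_, hac.symm, hpos, noP⟩
  by_contra hbc
  obtain ⟨r, s, hrs, hrb, hrc, hsb, hsc, u, hu1, hu2⟩ := hT.exists_crossing hP hbc' hbc
  have uU : U u = 0 := det3_eq_zero_of_mem_segment (openSegment_subset_segment _ _ _ hu1)
  obtain ⟨r, s, hrs, hrb, hrc, hu, hUr⟩ : ∃ r s : P, T.Adj r s ∧ r ≠ b ∧ r ≠ c ∧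
      u ∈ segment ℝ (r : Plane) s ∧ 0 < U r := by
    have hseg := openSegment_subset_segment _ _ _ hu2
    rcases aU.exists_pos_of_mem_openSegment hu2 uU (hP.det3_ne_zero hbc' hrb.symm hrc.symm) with h | h
    · exact ⟨r, s, hrs, hrb, hrc, hseg, h⟩
    · exact ⟨s, r, hrs.symm, hsb, hsc, by rwa [segment_symm], h⟩
  obtain ⟨t, t0, t1, ht⟩ := mem_openSegment_iff.1 hu1
  have uX : 0 < X u := by
    rw [← ht, aX.lineMap]
    have : X b = det3 (a : Plane) b c := by simp only [X]; rw [← det3_rotate (c : Plane)]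
    rw [this]; simp only [X, det3_self_outer]; nlinarith
  have uY : 0 < Y u := by
    rw [← ht, aY.lineMap]; simp only [Y, det3_self_right]; nlinarith
  have hra : r ≠ a := by
    rintro rfl; exact ray s hrs u uX uY uU.ge hu
  have hsa : s ≠ a := by
    rintro rfl; exact ray r hrs.symm u uX uY uU.ge (by rwa [segment_symm])
  obtain ⟨h1, h2⟩ := push r s hrs u hu uX uY (fun t t0 t1 => by rw [uU]; nlinarith) hra hsa
  exact noP r ⟨h2, hUr, h1⟩

/-! ### Convex quadrilaterals as regions -/

/-- The interior of the convex quadrilateral with vertices `a`, `d`, `b`, `c` in counterclockwise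
order. -/
def quad (a d b c : Plane) : Set Plane :=
  {x | 0 < det3 a d x ∧ 0 < det3 d b x ∧ 0 < det3 b c x ∧ 0 < det3 c a x}

lemma isOpen_pos {f : Plane → ℝ} (hf : IsAff f) : IsOpen {x | 0 < f x} :=
  isOpen_lt continuous_const hf.continuous

lemma isClosed_nonneg {f : Plane → ℝ} (hf : IsAff f) : IsClosed {x | 0 ≤ f x} :=
  isClosed_le continuous_const hf.continuous

lemma IsAff.convex_pos {f : Plane → ℝ} (hf : IsAff f) : Convex ℝ {x | 0 < f x} := by
  rw [convex_iff_segment_subset]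
  intro x hx y hy z hz
  obtain ⟨t, h0, h1, rfl⟩ := mem_segment_iff.1 hz
  simp only [Set.mem_ofPred_eq, hf.lineMap] at *
  rcases h0.lt_or_eq with h0 | rfl
  · have := mul_nonneg (sub_nonneg.2 h1) hx.le
    have := mul_pos h0 hy
    linarith
  · simpa using hx

lemma IsAff.convex_nonneg {f : Plane → ℝ} (hf : IsAff f) : Convex ℝ {x | 0 ≤ f x} := by
  rw [convex_iff_segment_subset]
  intro x hx y hy z hz
  obtain ⟨t, h0, h1, rfl⟩ := mem_segment_iff.1 hz
  simp only [Set.mem_ofPred_eq, hf.lineMap] at *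
  have := mul_nonneg (sub_nonneg.2 h1) hx
  have := mul_nonneg h0 hy
  linarith

/-- The interior of a closed half-plane is contained in the open half-plane. -/
lemma IsAff.pos_of_mem_interior {f : Plane → ℝ} (hf : IsAff f) {b x : Plane} (hb : 0 < f b)
    (hx : x ∈ interior {x | 0 ≤ f x}) : 0 < f x := by
  by_contra hc
  have h0 : f x = 0 := le_antisymm (not_lt.1 hc) (show x ∈ {x | 0 ≤ f x} from interior_subset hx)
  -- If `f x = 0`, a small step from `x` away from `b` stays in the interior but makes `f` negative.
  have hc : Continuous fun t : ℝ => (AffineMap.lineMap x b t : Plane) := AffineMap.lineMap_continuous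
  have hev : ∀ᶠ t in nhds (0 : ℝ), (AffineMap.lineMap x b t : Plane) ∈ interior {x | 0 ≤ f x} := by
    refine hc.continuousAt.eventually_mem ?_
    rw [AffineMap.lineMap_apply_zero]
    exact isOpen_interior.mem_nhds hx
  obtain ⟨ε, hε, h⟩ := Metric.eventually_nhds_iff.1 hev
  have h1 : (AffineMap.lineMap x b (-(ε / 2)) : Plane) ∈ interior {x | 0 ≤ f x} := h (by
    rw [Real.dist_eq, sub_zero, abs_neg, abs_of_pos (by linarith)]; linarith)
  have h2 : 0 ≤ f (AffineMap.lineMap x b (-(ε / 2))) :=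
    show (AffineMap.lineMap x b (-(ε / 2)) : Plane) ∈ {x | 0 ≤ f x} from interior_subset h1
  rw [hf.lineMap, h0] at h2
  nlinarith

lemma isOpen_quad (a d b c : Plane) : IsOpen (quad a d b c) :=
  (isOpen_pos (isAff_det3 a d)).inter ((isOpen_pos (isAff_det3 d b)).inter
    ((isOpen_pos (isAff_det3 b c)).inter (isOpen_pos (isAff_det3 c a))))

lemma convex_quad (a d b c : Plane) : Convex ℝ (quad a d b c) :=
  (isAff_det3 a d).convex_pos.inter ((isAff_det3 d b).convex_pos.inter
    ((isAff_det3 b c).convex_pos.inter (isAff_det3 c a).convex_pos))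

/-- The points `a`, `d`, `b`, `c` are in convex position, in counterclockwise order. -/
structure ConvexPosition (a d b c : Plane) : Prop where
  adb : 0 < det3 a d b
  dbc : 0 < det3 d b c
  bca : 0 < det3 b c a
  cad : 0 < det3 c a d

lemma ConvexPosition.rotate {a d b c : Plane} (h : ConvexPosition a d b c) :
    ConvexPosition d b c a := ⟨h.dbc, h.bca, h.cad, h.adb⟩

lemma mem_convexHull_of_triangle {a b c x : Plane} (h : 0 < det3 a b c) (h1 : 0 ≤ det3 a b x)
    (h2 : 0 ≤ det3 b c x) (h3 : 0 ≤ det3 c a x) {S : Set Plane} (ha : a ∈ S) (hb : b ∈ S)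
    (hc : c ∈ S) : x ∈ convexHull ℝ S := by
  have hsum : det3 a b x + det3 b c x + det3 c a x = det3 a b c := by unfold det3; ring
  have hx : x = (det3 b c x / det3 a b c) • a + (det3 c a x / det3 a b c) • b +
      (det3 a b x / det3 a b c) • c := by
    have e0 := frame_eq h.ne' x 0
    have e1 := frame_eq h.ne' x 1
    have hX : coordX a b c x = det3 c a x / det3 a b c := by
      rw [coordX, ← det3_rotate a x c, ← det3_rotate x c a]
    have hU : det3 b c x / det3 a b c = 1 - det3 c a x / det3 a b c - det3 a b x / det3 a b c := by
      field_simp; linarith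
    apply plane_ext <;> simp only [PiLp.add_apply, PiLp.smul_apply, smul_eq_mul, hU]
    · rw [e0, hX, coordY]; ring
    · rw [e1, hX, coordY]; ring
  have hconv := convex_convexHull ℝ S
  have key := hconv.sum_mem (t := Finset.univ) (w := ![det3 b c x / det3 a b c,
      det3 c a x / det3 a b c, det3 a b x / det3 a b c]) (z := ![a, b, c])
    (by intro i _; fin_cases i <;> simp <;> positivity)
    (by simp [Fin.sum_univ_three]; field_simp; linarith)
    (by intro i _; fin_cases i <;> simp <;> apply subset_convexHull ℝ S <;> assumption)
  rw [hx]
  simpa [Fin.sum_univ_three] using key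

/-- Each side gives a closed half-plane containing the hull. Conversely, the diagonal `ab` splits
the quadrilateral into two triangles with corners in the given set. -/
lemma ConvexPosition.interior_convexHull {a d b c : Plane} (h : ConvexPosition a d b c) :
    interior (convexHull ℝ ({a, b, c, d} : Set Plane)) = quad a d b c := by
  have half : ∀ {a d b c : Plane}, ConvexPosition a d b c →
      ∀ x ∈ interior (convexHull ℝ ({a, b, c, d} : Set Plane)), 0 < det3 a d x := by
    intro a d b c h x hx
    refine (isAff_det3 a d).pos_of_mem_interior h.adb (interior_mono ?_ hx)
    refine convexHull_min ?_ (isAff_det3 a d).convex_nonneg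
    intro y hy
    simp only [Set.mem_insert_iff, Set.mem_singleton_iff] at hy
    rcases hy with rfl | rfl | rfl | rfl
    · simp
    · exact h.adb.le
    · exact (by rw [det3_rotate y a d] ; exact h.cad.le : 0 ≤ det3 a d y)
    · simp
  apply Set.Subset.antisymm
  · intro x hx
    refine ⟨half h x hx, half h.rotate x ?_, half h.rotate.rotate x ?_,
      half h.rotate.rotate.rotate x ?_⟩ <;> convert hx using 3 <;> ext y <;>
      simp only [Set.mem_insert_iff, Set.mem_singleton_iff] <;> tauto
  · refine interior_maximal ?_ (isOpen_quad a d b c)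
    rintro x ⟨h1, h2, h3, h4⟩
    rcases le_total 0 (det3 a b x) with h0 | h0
    · exact mem_convexHull_of_triangle (a := a) (b := b) (c := c)
        (by rw [← det3_rotate]; exact h.bca) h0 h3.le h4.le (by simp) (by simp) (by simp)
    · exact mem_convexHull_of_triangle (a := b) (b := a) (c := d)
        (by rw [det3_rotate d b a, det3_rotate a d b] ; exact h.adb)
        (by rw [det3_swap]; linarith) h1.le h2.le (by simp) (by simp) (by simp)

/-- A boundary point of a convex quadrilateral lies on one of its sides. -/
lemma ConvexPosition.mem_side {a d b c y : Plane} (h : ConvexPosition a d b c)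
    (hy : y ∈ closure (quad a d b c)) (hy' : y ∉ quad a d b c) :
    y ∈ segment ℝ a d ∨ y ∈ segment ℝ d b ∨ y ∈ segment ℝ b c ∨ y ∈ segment ℝ c a := by
  have side : ∀ {a d b c : Plane}, ConvexPosition a d b c → det3 a d y = 0 → 0 ≤ det3 d b y →
      0 ≤ det3 c a y → y ∈ segment ℝ a d := by
    intro a d b c h h0 h1 h2
    have hY : coordY a d b y = 0 := by rw [coordY, h0, zero_div]
    have e := eq_lineMap_of_coordY_eq_zero h.adb.ne' hY
    refine mem_segment_iff.2 ⟨coordX a d b y, ?_, ?_, e⟩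
    · rw [← e, (isAff_det3 _ _).lineMap] at h2
      simp only [det3_self_right, mul_zero, zero_add] at h2
      exact nonneg_of_mul_nonneg_left h2 h.cad
    · rw [← e, (isAff_det3 _ _).lineMap] at h1
      simp only [det3_self_outer, mul_zero, add_zero, det3_rotate] at h1
      have := nonneg_of_mul_nonneg_left h1 h.adb
      linarith
  have hcl : quad a d b c ⊆ {x | 0 ≤ det3 a d x} ∩ {x | 0 ≤ det3 d b x} ∩ {x | 0 ≤ det3 b c x} ∩
      {x | 0 ≤ det3 c a x} := fun x hx => ⟨⟨⟨hx.1.le, hx.2.1.le⟩, hx.2.2.1.le⟩, hx.2.2.2.le⟩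
  obtain ⟨⟨⟨h1, h2⟩, h3⟩, h4⟩ := closure_minimal hcl
    ((((isClosed_nonneg (isAff_det3 a d)).inter (isClosed_nonneg (isAff_det3 d b))).inter
      (isClosed_nonneg (isAff_det3 b c))).inter (isClosed_nonneg (isAff_det3 c a))) hy
  simp only [Set.mem_ofPred_eq] at h1 h2 h3 h4
  by_contra hc
  push Not at hc
  obtain ⟨c1, c2, c3, c4⟩ := hc
  apply hy'
  refine ⟨h1.lt_of_ne' fun e => c1 (side h e h2 h4), h2.lt_of_ne' fun e => c2 (side h.rotate e h3 h1),
    h3.lt_of_ne' fun e => c3 (side h.rotate.rotate e h4 h2),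
    h4.lt_of_ne' fun e => c4 (side h.rotate.rotate.rotate e h1 h3)⟩

/-- A convex quadrilateral whose sides are edges of a graph and whose interior is not met by any edge
is a region of the graph. -/
lemma ConvexPosition.mem_regions {G : SimpleGraph P} {a d b c : P}
    (h : ConvexPosition (a : Plane) d b c) (had : G.Adj a d) (hdb : G.Adj d b) (hbc : G.Adj b c)
    (hca : G.Adj c a)
    (hQ : ∀ p q : P, G.Adj p q → ∀ x ∈ segment ℝ (p : Plane) q, x ∉ quad (a : Plane) d b c) :
    interior (convexHull ℝ ({(a : Plane), (b : Plane), (c : Plane), (d : Plane)} : Set Plane)) ∈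
      regions G := by
  have mem_union : ∀ {p q : P}, G.Adj p q → segment ℝ (p : Plane) q ⊆ edgeUnion G := by
    intro p q hpq x hx
    exact Set.mem_biUnion (show s(p, q) ∈ G.edgeSet from hpq) hx
  have hsub : quad (a : Plane) d b c ⊆ (edgeUnion G)ᶜ := by
    intro x hx hx'
    obtain ⟨e, he, hxe⟩ := Set.mem_iUnion₂.1 hx'
    induction e with
    | h p q => exact hQ p q he x hxe hx
  rw [h.interior_convexHull]
  refine ⟨?_, ?_⟩
  · rw [← h.interior_convexHull]
    refine Bornology.IsBounded.subset ?_ interior_subset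
    exact (isBounded_convexHull.2 (Set.toFinite _).isBounded)
  · -- the quadrilateral contains an interior point of the diagonal `ab`
    have hne : (quad (a : Plane) d b c).Nonempty := by
      refine ⟨AffineMap.lineMap (a : Plane) (b : Plane) (1 / 2 : ℝ), ?_, ?_, ?_, ?_⟩ <;>
        rw [(isAff_det3 _ _).lineMap] <;>
        simp only [det3_self_outer, det3_self_right, mul_zero, zero_add, add_zero]
      · have := h.adb; linarith
      · have := h.adb; rw [det3_rotate]; linarith
      · have := h.bca; linarith
      · have := h.bca; rw [det3_rotate]; linarith
    obtain ⟨x, hx⟩ := hne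
    refine ⟨x, hsub hx, Set.Subset.antisymm ?_ ?_⟩
    · exact (convex_quad _ _ _ _).isPreconnected.subset_connectedComponentIn hx hsub
    -- The component is connected and meets the open quadrilateral, but cannot reach its boundary,
    -- which is covered by edges.
    · refine isPreconnected_connectedComponentIn.subset_of_closure_inter_subset
        (isOpen_quad _ _ _ _) ⟨x, mem_connectedComponentIn (hsub hx), hx⟩ ?_
      rintro y ⟨hy, hyK⟩
      by_contra hyQ
      have hyc := connectedComponentIn_subset _ _ hyK
      rcases h.mem_side hy hyQ with h | h | h | h
      · exact hyc (mem_union had h)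
      · exact hyc (mem_union hdb h)
      · exact hyc (mem_union hbc h)
      · exact hyc (mem_union hca h)

/-! ### Flipping the diagonal of a convex quadrilateral -/

/-- The faces `abc` and `bad` form a convex quadrilateral with diagonals `ab` and `cd`. -/
structure IsConvexPair (T : SimpleGraph P) (a b c d : P) : Prop where
  left : IsFace T a b c
  right : IsFace T b a d
  pos : 0 < det3 (d : Plane) c a
  pos' : 0 < det3 (d : Plane) b c

namespace IsConvexPair
variable {a b c d : P} (h : IsConvexPair T a b c d)
include h

lemma convexPosition : ConvexPosition (a : Plane) d b c :=
  ⟨by rw [det3_rotate]; exact h.right.pos, h.pos', by rw [det3_rotate]; exact h.left.pos,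
    by rw [det3_rotate]; exact h.pos⟩

/-- The values `A` and `B` of `det3 d c` at `a` and `b` have opposite signs, so this function
vanishes on `ab` at the parameter `A / (A - B)`. -/
lemma exists_mem : ∃ x, x ∈ openSegment ℝ (a : Plane) b ∧ x ∈ openSegment ℝ (c : Plane) d ∧
    x ∈ quad (a : Plane) d b c := by
  have hq := h.convexPosition
  obtain ⟨h1, h2, h3, h4⟩ := hq
  have hp := h.pos
  have hn : det3 (d : Plane) c b < 0 := by rw [det3_swap']; linarith
  obtain ⟨A, hA⟩ : ∃ A, A = det3 (d : Plane) c a := ⟨_, rfl⟩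
  obtain ⟨B, hB⟩ : ∃ B, B = det3 (d : Plane) c b := ⟨_, rfl⟩
  rw [← hA] at hp
  rw [← hB] at hn
  have t0 : 0 < A / (A - B) := div_pos hp (by linarith)
  have t1 : A / (A - B) < 1 := by rw [div_lt_one (by linarith)]; linarith
  have hz : (1 - A / (A - B)) * A + A / (A - B) * B = 0 := by
    have : A - B ≠ 0 := by linarith
    field_simp; ring
  generalize A / (A - B) = t at t0 t1 hz
  have t1' : 0 < 1 - t := by linarith
  obtain ⟨x, hx⟩ : ∃ x : Plane, x = AffineMap.lineMap (a : Plane) (b : Plane) t := ⟨_, rfl⟩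
  have q1 : 0 < det3 (a : Plane) d x := by
    rw [hx, (isAff_det3 _ _).lineMap]; simp; positivity
  have q2 : 0 < det3 (d : Plane) b x := by
    rw [hx, (isAff_det3 _ _).lineMap, det3_rotate (a : Plane)]; simp; positivity
  have q3 : 0 < det3 (b : Plane) c x := by
    rw [hx, (isAff_det3 _ _).lineMap]; simp; positivity
  have q4 : 0 < det3 (c : Plane) a x := by
    rw [hx, (isAff_det3 _ _).lineMap, det3_rotate (b : Plane)]; simp; positivity
  have hab : det3 (a : Plane) b x = 0 := by rw [hx, (isAff_det3 _ _).lineMap]; simp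
  refine ⟨x, mem_openSegment_iff.2 ⟨t, t0, t1, hx.symm⟩, ?_, q1, q2, q3, q4⟩
  refine mem_openSegment_of_ne_left_right ?_ ?_ ?_
  · rintro e; rw [← e] at hab; exact h.left.pos.ne' hab
  · rintro e; rw [← e] at hab; have := h.right.pos; rw [det3_swap, hab] at this; simp at this
  · refine mem_segment_of_det3 (c := (b : Plane)) (by rw [← det3_rotate (c : Plane) d b]; exact h2) ?_ q2.le q3.le
    rw [det3_swap, hx, (isAff_det3 _ _).lineMap, ← hA, ← hB, hz, neg_zero]

/-- The only edge that meets the interior of the quadrilateral is the diagonal `ab`. -/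
lemma not_mem_quad (hT : IsPlane T) {p q : P} (hpq : T.Adj p q) (hne : s(p, q) ≠ s(a, b))
    {x : Plane} (hx : x ∈ segment ℝ (p : Plane) q) : x ∉ quad (a : Plane) d b c := by
  rintro ⟨h1, h2, h3, h4⟩
  rcases lt_trichotomy (det3 (a : Plane) b x) 0 with h0 | h0 | h0
  · exact h.right.not_mem_segment hT hpq hx ⟨by rw [det3_swap]; linarith, h1, h2⟩
  · have hxab := mem_segment_of_det3 h.left.pos h0 h3.le h4.le
    rcases hT.inter hpq h.left.ab hx hxab with h' | ⟨e, -, rfl | rfl, h'⟩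
    · exact hne h'
    · rw [h'] at h1; simp at h1
    · rw [h'] at h3; simp at h3
  · exact h.left.not_mem_segment hT hpq hx ⟨h0, h3, h4⟩

/-- The crossing point of the diagonals is interior to the quadrilateral, where only `ab` may pass.
Consequently the edge created by one flip is never the edge removed by another. -/
lemma not_adj (hT : IsPlane T) : ¬ T.Adj c d := by
  intro hcd
  obtain ⟨x, -, hx, hxq⟩ := h.exists_mem
  refine h.not_mem_quad hT hcd ?_ (openSegment_subset_segment _ _ _ hx) hxq
  intro e
  have : c ∈ s(a, b) := by rw [← e]; exact Sym2.mem_mk_left c d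
  rcases Sym2.mem_iff.1 this with rfl | rfl
  · exact h.left.ca.ne rfl
  · exact h.left.bc.ne rfl

lemma not_isHullEdge : ¬ IsHullEdge s(a, b) := by
  rintro ⟨-, hs⟩
  obtain ⟨x, hx, -, hxq⟩ := h.exists_mem
  have h1 : x ∈ frontier (convexHull ℝ (P : Set Plane)) :=
    hs (openSegment_subset_segment _ _ _ hx)
  rw [← h.convexPosition.interior_convexHull] at hxq
  refine h1.2 (interior_mono (convexHull_mono ?_) hxq)
  intro y hy
  simp only [Set.mem_insert_iff, Set.mem_singleton_iff] at hy
  rcases hy with rfl | rfl | rfl | rfl <;> simp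

/-- The edge `ab` can be flipped in every graph that contains it together with the sides of the
quadrilateral, and has no other edge meeting the quadrilateral. -/
lemma isOtherDiagonal {G : SimpleGraph P} (hab : G.Adj a b) (had : G.Adj a d) (hdb : G.Adj d b)
    (hbc : G.Adj b c) (hca : G.Adj c a)
    (hQ : ∀ p q : P, G.Adj p q → s(p, q) ≠ s(a, b) → ∀ x ∈ segment ℝ (p : Plane) q,
      x ∉ quad (a : Plane) d b c) : IsOtherDiagonal G s(a, b) s(c, d) := by
  obtain ⟨x, hx, hx', -⟩ := h.exists_mem
  refine ⟨⟨hab, h.not_isHullEdge⟩, a, b, c, d, rfl, rfl, ⟨x, hx, hx'⟩, ?_⟩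
  have n1 := h.left.ab.ne
  have n2 := h.left.bc.ne
  have n3 := h.left.ca.ne
  have n4 := h.right.bc.ne
  have n5 := h.right.ca.ne
  have hdel : ∀ p q : P, G.Adj p q → s(p, q) ≠ s(a, b) → (G.deleteEdges {s(a, b)}).Adj p q := by
    intro p q h1 h2
    rw [SimpleGraph.deleteEdges_adj]
    exact ⟨h1, h2⟩
  refine h.convexPosition.mem_regions (hdel _ _ had ?_) (hdel _ _ hdb ?_) (hdel _ _ hbc ?_)
    (hdel _ _ hca ?_) ?_
  · simp only [ne_eq, Sym2.eq_iff]; tauto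
  · simp only [ne_eq, Sym2.eq_iff]; tauto
  · simp only [ne_eq, Sym2.eq_iff]; tauto
  · simp only [ne_eq, Sym2.eq_iff]; tauto
  · intro p q hpq
    rw [SimpleGraph.deleteEdges_adj] at hpq
    exact hQ p q hpq.1 hpq.2

lemma isOtherDiagonal_self (hT : IsPlane T) : IsOtherDiagonal T s(a, b) s(c, d) :=
  h.isOtherDiagonal h.left.ab h.right.bc h.right.ca h.left.bc h.left.ca
    fun _ _ hpq hne _ hx => h.not_mem_quad hT hpq hne hx

end IsConvexPair

/-! ### Independence of flips without a common face -/

/-- The edges `e` and `f` do not lie in a common face of `T`. -/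
def NoCommonFace (T : SimpleGraph P) (e f : Sym2 P) : Prop :=
  ∀ x y z : P, IsFace T x y z → (∀ v ∈ e, v = x ∨ v = y ∨ v = z) →
    ¬ ∀ v ∈ f, v = x ∨ v = y ∨ v = z

lemma NoCommonFace.symm {e f : Sym2 P} (h : NoCommonFace T e f) : NoCommonFace T f e :=
  fun x y z hf he hf' => h x y z hf hf' he

lemma mem_sym2_cases {p q x y z : P} (hp : p = x ∨ p = y ∨ p = z) (hq : q = x ∨ q = y ∨ q = z) :
    ∀ v ∈ s(p, q), v = x ∨ v = y ∨ v = z := by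
  intro v hv
  rcases Sym2.mem_iff.1 hv with rfl | rfl <;> assumption

/-- The sides of the quadrilateral of `ab` differ from an edge that has no face in common with
`ab`. -/
lemma IsConvexPair.side_ne {a b c d : P} (h : IsConvexPair T a b c d) {e : Sym2 P}
    (he : NoCommonFace T s(a, b) e) :
    s(a, d) ≠ e ∧ s(d, b) ≠ e ∧ s(b, c) ≠ e ∧ s(c, a) ≠ e := by
  refine ⟨?_, ?_, ?_, ?_⟩ <;> rintro rfl
  · exact he _ _ _ h.right (mem_sym2_cases (by simp) (by simp)) (mem_sym2_cases (by simp) (by simp))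
  · exact he _ _ _ h.right (mem_sym2_cases (by simp) (by simp)) (mem_sym2_cases (by simp) (by simp))
  · exact he _ _ _ h.left (mem_sym2_cases (by simp) (by simp)) (mem_sym2_cases (by simp) (by simp))
  · exact he _ _ _ h.left (mem_sym2_cases (by simp) (by simp)) (mem_sym2_cases (by simp) (by simp))

/-- The new edge of a flip does not meet a quadrilateral without common face. -/
lemma IsConvexPair.not_mem_quad_of_noCommonFace (hT : IsPlane T) {a b c d a' b' c' d' : P}
    (h : IsConvexPair T a b c d) (h' : IsConvexPair T a' b' c' d')
    (hne : s(a, b) ≠ s(a', b')) (hN : NoCommonFace T s(a, b) s(a', b')) {x : Plane}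
    (hx : x ∈ segment ℝ (c : Plane) d) : x ∉ quad (a' : Plane) d' b' c' := by
  intro hxQ'
  obtain ⟨s1, s2, s3, s4⟩ := h.side_ne hN
  have hxc : x ≠ c := by
    rintro rfl
    exact h'.not_mem_quad hT h.left.bc s3 (right_mem_segment ℝ _ _) hxQ'
  have hxd : x ≠ d := by
    rintro rfl
    exact h'.not_mem_quad hT h.right.bc s1 (right_mem_segment ℝ _ _) hxQ'
  have hxQ : x ∈ quad (a : Plane) d b c := by
    obtain ⟨t, t0, t1, rfl⟩ := mem_openSegment_iff.1
      (mem_openSegment_of_ne_left_right hxc.symm hxd.symm hx)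
    obtain ⟨h1, h2, h3, h4⟩ := h.convexPosition
    have t1' : 0 < 1 - t := by linarith
    refine ⟨?_, ?_, ?_, ?_⟩ <;> rw [(isAff_det3 _ _).lineMap] <;>
      simp only [det3_self_outer, det3_self_right, mul_zero, zero_add, add_zero]
    · rw [det3_rotate]; positivity
    · positivity
    · rw [det3_rotate]; positivity
    · positivity
  -- The second quadrilateral is connected and avoids the sides of the first, which are edges other
  -- than `a'b'`. If it lay inside the first, `a'b'` would be an edge besides `ab` meeting the
  -- first.
  have hsub : quad (a' : Plane) d' b' c' ⊆ quad (a : Plane) d b c := by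
    refine (convex_quad _ _ _ _).isPreconnected.subset_of_closure_inter_subset
      (isOpen_quad _ _ _ _) ⟨x, hxQ', hxQ⟩ ?_
    rintro y ⟨hy, hyQ'⟩
    by_contra hyQ
    rcases h.convexPosition.mem_side hy hyQ with hs | hs | hs | hs
    · exact h'.not_mem_quad hT h.right.bc s1 hs hyQ'
    · exact h'.not_mem_quad hT h.right.ca s2 hs hyQ'
    · exact h'.not_mem_quad hT h.left.bc s3 hs hyQ'
    · exact h'.not_mem_quad hT h.left.ca s4 hs hyQ'
  obtain ⟨y, hy, -, hyQ'⟩ := h'.exists_mem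
  exact h.not_mem_quad hT h'.left.ab hne.symm (openSegment_subset_segment _ _ _ hy) (hsub hyQ')

/-- The edge `ab` remains flippable after a flip without common face. -/
lemma IsConvexPair.isOtherDiagonal_flip (hT : IsPlane T) {a b c d a' b' c' d' : P}
    (h : IsConvexPair T a b c d) (h' : IsConvexPair T a' b' c' d')
    (hne : s(a, b) ≠ s(a', b')) (hN : NoCommonFace T s(a, b) s(a', b')) :
    IsOtherDiagonal (T.deleteEdges {s(a', b')} ⊔ SimpleGraph.fromEdgeSet {s(c', d')})
      s(a, b) s(c, d) := by
  obtain ⟨s1, s2, s3, s4⟩ := h.side_ne hN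
  have hkeep : ∀ p q : P, T.Adj p q → s(p, q) ≠ s(a', b') →
      (T.deleteEdges {s(a', b')} ⊔ SimpleGraph.fromEdgeSet {s(c', d')}).Adj p q := by
    intro p q h1 h2
    refine Or.inl ?_
    rw [SimpleGraph.deleteEdges_adj]
    exact ⟨h1, h2⟩
  refine h.isOtherDiagonal (hkeep _ _ h.left.ab hne) (hkeep _ _ h.right.bc s1)
    (hkeep _ _ h.right.ca s2) (hkeep _ _ h.left.bc s3) (hkeep _ _ h.left.ca s4) ?_
  rintro p q (hpq | hpq) hpqe x hx
  · rw [SimpleGraph.deleteEdges_adj] at hpq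
    exact h.not_mem_quad hT hpq.1 hpqe hx
  · rw [SimpleGraph.fromEdgeSet_adj] at hpq
    have hx' : x ∈ edgeSegment s(c', d') := by
      have e : s(p, q) = s(c', d') := hpq.1
      rw [← e]; exact hx
    exact h'.not_mem_quad_of_noCommonFace hT h hne.symm hN.symm hx'

/-- Flippable edges without common face are independently flippable. -/
lemma IsConvexPair.independentlyFlippable (hT : IsPlane T) {a b c d a' b' c' d' : P}
    (h : IsConvexPair T a b c d) (h' : IsConvexPair T a' b' c' d')
    (hne : s(a, b) ≠ s(a', b')) (hN : NoCommonFace T s(a, b) s(a', b')) :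
    IndependentlyFlippable T s(a, b) s(a', b') := by
  refine ⟨hne, _, _, _, ⟨_, h.isOtherDiagonal_self hT, rfl⟩, ⟨_, h'.isOtherDiagonal_self hT, rfl⟩,
    ⟨_, h'.isOtherDiagonal_flip hT h hne.symm hN.symm, rfl⟩,
    ⟨_, h.isOtherDiagonal_flip hT h' hne hN, ?_⟩⟩
  have n1 : s(c, d) ≠ s(a', b') := by
    intro e
    apply h.not_adj hT
    have : s(a', b') ∈ T.edgeSet := h'.left.ab
    rw [← e] at this; exact this
  have n2 : s(c', d') ≠ s(a, b) := by
    intro e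
    apply h'.not_adj hT
    have : s(a, b) ∈ T.edgeSet := h.left.ab
    rw [← e] at this; exact this
  ext p q
  simp only [SimpleGraph.sup_adj, SimpleGraph.deleteEdges_adj, SimpleGraph.fromEdgeSet_adj,
    Set.mem_singleton_iff]
  constructor
  · rintro (⟨⟨h1, h2⟩ | ⟨h1, h2⟩, h3⟩ | ⟨h1, h2⟩)
    · exact Or.inl ⟨Or.inl ⟨h1, h3⟩, h2⟩
    · exact Or.inr ⟨h1, h2⟩
    · exact Or.inl ⟨Or.inr ⟨h1, h2⟩, by rw [h1]; exact n2⟩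
  · rintro (⟨⟨h1, h2⟩ | ⟨h1, h2⟩, h3⟩ | ⟨h1, h2⟩)
    · exact Or.inl ⟨Or.inl ⟨h1, h3⟩, h2⟩
    · exact Or.inr ⟨h1, h2⟩
    · exact Or.inl ⟨Or.inr ⟨h1, h2⟩, by rw [h1]; exact n1⟩

/-! ### A matching bound for maximum degree three -/

/-- Weight of a node of degree `d` in the matching bound. -/
def degreeWeight (d : ℕ) : ℕ := if d ≤ 1 then 0 else if d = 2 then 3 else 4

lemma degreeWeight_mono : Monotone degreeWeight := by
  intro a b h; unfold degreeWeight; split_ifs <;> omega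

open Classical in
/-- A matching bound for graphs of maximum degree three, given by an incidence relation `I`
between nodes and edges. -/
lemma exists_matching {ε W : Type*} [Fintype W] (I : W → ε → Prop) (E : Finset ε)
    (two : ∀ e ∈ E, ∃ x y, x ≠ y ∧ ∀ z, I z e ↔ z = x ∨ z = y)
    (simple : ∀ e ∈ E, ∀ f ∈ E, e ≠ f → ∀ x y, x ≠ y → I x e → I y e → I x f → I y f → False)
    (deg : ∀ x, (E.filter (I x)).card ≤ 3) :
    ∃ M ⊆ E, (∀ e ∈ M, ∀ f ∈ M, e ≠ f → ∀ x, I x e → ¬ I x f) ∧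
      3 * E.card ≤ 5 * M.card + ∑ x, degreeWeight (E.filter (I x)).card := by
  induction hn : E.card using Nat.strong_induction_on generalizing E with
  | _ n ih =>
  subst hn
  rcases E.eq_empty_or_nonempty with rfl | hE
  · exact ⟨∅, by simp, by simp, by simp⟩
  -- a node of least positive degree
  obtain ⟨x, hx, hmin⟩ : ∃ x, (E.filter (I x)).Nonempty ∧
      ∀ z, (E.filter (I z)).Nonempty → (E.filter (I x)).card ≤ (E.filter (I z)).card := by
    obtain ⟨e, he⟩ := hE
    obtain ⟨x, y, -, h⟩ := two e he
    obtain ⟨x, hx, hmin⟩ := Finset.exists_min_image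
      (Finset.univ.filter fun z => (E.filter (I z)).Nonempty) (fun z => (E.filter (I z)).card)
      ⟨x, by simp only [Finset.mem_filter, Finset.mem_univ, true_and]
             exact ⟨e, by simp [he, h]⟩⟩
    simp only [Finset.mem_filter, Finset.mem_univ, true_and] at hx hmin
    exact ⟨x, hx, hmin⟩
  obtain ⟨e, he⟩ := hx
  obtain ⟨heE, hxe⟩ := Finset.mem_filter.1 he
  obtain ⟨y, hxy, hends⟩ : ∃ y, x ≠ y ∧ ∀ z, I z e ↔ z = x ∨ z = y := by
    obtain ⟨x', y', hne, h⟩ := two e heE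
    rcases (h x).1 hxe with rfl | rfl
    · exact ⟨y', hne, h⟩
    · exact ⟨x', hne.symm, fun z => by rw [h z]; tauto⟩
  have hye : I y e := (hends y).2 (Or.inr rfl)
  let E' := E.filter fun f => ¬ I x f ∧ ¬ I y f
  have hsub : E' ⊆ E := Finset.filter_subset _ _
  -- Putting `e` into the matching removes all edges at `x` or `y`; the `1` appears because `e` is
  -- incident with both.
  have hcard : E.card + 1 ≤ E'.card + (E.filter (I x)).card + (E.filter (I y)).card := by
    have h1 : E ⊆ E' ∪ (E.filter (I x) ∪ E.filter (I y)) := by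
      intro f hf
      simp only [E', Finset.mem_union, Finset.mem_filter, hf, true_and]
      tauto
    have h2 := (Finset.card_le_card h1).trans (Finset.card_union_le _ _)
    have h3 := Finset.card_union_add_card_inter (E.filter (I x)) (E.filter (I y))
    have h4 : 0 < (E.filter (I x) ∩ E.filter (I y)).card :=
      Finset.card_pos.2 ⟨e, by simp [heE, hxe, hye]⟩
    omega
  have hlt : E'.card < E.card :=
    Finset.card_lt_card ⟨hsub, fun h => by
      have := h heE
      simp [E', hxe] at this⟩
  have hdeg' : ∀ z, (E'.filter (I z)).card ≤ (E.filter (I z)).card := fun z =>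
    Finset.card_le_card (Finset.filter_subset_filter _ hsub)
  obtain ⟨M, hM, hMd, hMc⟩ := ih E'.card hlt E' (fun f hf => two f (hsub hf))
    (fun f hf g hg => simple f (hsub hf) g (hsub hg)) (fun z => (hdeg' z).trans (deg z)) rfl
  have heM : e ∉ M := fun h => by have := hM h; simp [E', hxe] at this
  have hmeet : ∀ f ∈ M, ∀ z, I z e → ¬ I z f := by
    intro f hf z hz hzf
    have := (Finset.mem_filter.1 (hM hf)).2
    rcases (hends z).1 hz with rfl | rfl
    · exact this.1 hzf
    · exact this.2 hzf
  refine ⟨insert e M, ?_, ?_, ?_⟩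
  · exact Finset.insert_subset heE (hM.trans hsub)
  · intro f hf g hg hfg z hzf hzg
    rcases Finset.mem_insert.1 hf with hf' | hf' <;> rcases Finset.mem_insert.1 hg with hg' | hg'
    · exact hfg (hf'.trans hg'.symm)
    · exact hmeet g hg' z (hf' ▸ hzf) hzg
    · exact hmeet f hf' z (hg' ▸ hzg) hzf
    · exact hMd f hf' g hg' hfg z hzf hzg
  rw [Finset.card_insert_of_notMem heM]
  -- Weights never increase, so the total drop is at least the drop on any set `S` of nodes.
  have hsum : ∀ S : Finset W, ∑ z ∈ S, degreeWeight (E.filter (I z)).card +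
      ∑ z, degreeWeight (E'.filter (I z)).card ≤
      ∑ z, degreeWeight (E.filter (I z)).card + ∑ z ∈ S, degreeWeight (E'.filter (I z)).card := by
    intro S
    have h1 := Finset.sum_add_sum_compl S (fun z => degreeWeight (E.filter (I z)).card)
    have h2 := Finset.sum_add_sum_compl S (fun z => degreeWeight (E'.filter (I z)).card)
    have h3 : ∑ z ∈ Sᶜ, degreeWeight (E'.filter (I z)).card ≤
        ∑ z ∈ Sᶜ, degreeWeight (E.filter (I z)).card :=
      Finset.sum_le_sum fun z _ => degreeWeight_mono (hdeg' z)
    omega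
  have hx0 : degreeWeight (E'.filter (I x)).card = 0 := by
    have : E'.filter (I x) = ∅ :=
      Finset.filter_eq_empty_iff.2 fun f hf => (Finset.mem_filter.1 hf).2.1
    rw [this]; rfl
  have hy0 : degreeWeight (E'.filter (I y)).card = 0 := by
    have : E'.filter (I y) = ∅ :=
      Finset.filter_eq_empty_iff.2 fun f hf => (Finset.mem_filter.1 hf).2.2
    rw [this]; rfl
  have hxy' := hmin y ⟨e, by simp [heE, hye]⟩
  have hx1 : 1 ≤ (E.filter (I x)).card := Finset.card_pos.2 ⟨e, he⟩
  have hx3 := deg x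
  have hy3 := deg y
  have hS := hsum {x, y}
  rw [Finset.sum_pair hxy, Finset.sum_pair hxy, hx0, hy0] at hS
  by_cases h3 : (E.filter (I x)).card = 3
  · -- all degrees are three: two further neighbours lose an edge
    have hyd : (E.filter (I y)).card = 3 := by omega
    have h2 : 1 < ((E.filter (I x)).erase e).card := by rw [Finset.card_erase_of_mem he]; omega
    obtain ⟨f, hf, g, hg, hfg⟩ := Finset.one_lt_card.1 h2
    have other : ∀ f ∈ (E.filter (I x)).erase e, ∃ p, p ≠ x ∧ p ≠ y ∧ I p f ∧ f ∈ E ∧ I x f ∧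
        degreeWeight (E'.filter (I p)).card + 1 ≤ degreeWeight (E.filter (I p)).card := by
      intro f hf
      obtain ⟨hfe, hf⟩ := Finset.mem_erase.1 hf
      obtain ⟨hfE, hxf⟩ := Finset.mem_filter.1 hf
      obtain ⟨p, hpx, hpf⟩ : ∃ p, p ≠ x ∧ I p f := by
        obtain ⟨x', y', hne, h⟩ := two f hfE
        rcases (h x).1 hxf with rfl | rfl
        · exact ⟨y', hne.symm, (h _).2 (Or.inr rfl)⟩
        · exact ⟨x', hne, (h _).2 (Or.inl rfl)⟩
      have hpy : p ≠ y := by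
        rintro rfl
        exact simple e heE f hfE hfe.symm x p hpx.symm hxe hye hxf hpf
      refine ⟨p, hpx, hpy, hpf, hfE, hxf, ?_⟩
      have hp3 := deg p
      have hpm := hmin p ⟨f, by simp [hfE, hpf]⟩
      have hlt : (E'.filter (I p)).card < (E.filter (I p)).card := by
        refine Finset.card_lt_card ⟨Finset.filter_subset_filter _ hsub, fun h => ?_⟩
        have : f ∈ E'.filter (I p) := h (by simp [hfE, hpf])
        simp [E', hxf] at this
      have e1 : (E.filter (I p)).card = 3 := by omega
      have e2 : (E'.filter (I p)).card ≤ 2 := by omega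
      have := degreeWeight_mono e2
      rw [e1]
      simp only [degreeWeight] at this ⊢
      norm_num at this ⊢
      omega
    obtain ⟨p, hpx, hpy, hpf, hfE, hxf, hp⟩ := other f hf
    obtain ⟨q, hqx, hqy, hqg, hgE, hxg, hq⟩ := other g hg
    have hpq : p ≠ q := by
      rintro rfl
      exact simple f hfE g hgE hfg x p hpx.symm hxf hpf hxg hqg
    -- For two nodes of degree three, `5` and the weights of `x` and `y` fall short by `2` of paying
    -- for five removed edges; the unit drops at `p` and `q` supply this.
    have hS := hsum {x, y, p, q}
    rw [Finset.sum_insert (by simp [hxy, hpx.symm, hqx.symm]),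
      Finset.sum_insert (by simp [hpy.symm, hqy.symm]), Finset.sum_pair hpq,
      Finset.sum_insert (by simp [hxy, hpx.symm, hqx.symm]),
      Finset.sum_insert (by simp [hpy.symm, hqy.symm]), Finset.sum_pair hpq, hx0, hy0, h3, hyd] at hS
    have w3 : degreeWeight 3 = 4 := rfl
    rw [w3] at hS
    omega
  · generalize (E.filter (I x)).card = dx at *
    generalize (E.filter (I y)).card = dy at *
    -- Three units for each of at most `dx + dy - 1` removed edges are paid by `5` for `e` and the
    -- freed weights. Equality occurs for degrees `1, 3` and `2, 3`.
    have key : 3 * (dx + dy) ≤ 8 + degreeWeight dx + degreeWeight dy := by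
      unfold degreeWeight
      split_ifs <;> omega
    omega

/-! ### Reflex angles -/

/-- The quadrilateral with diagonal `vx` has a reflex angle at `v`. -/
def IsReflex (T : SimpleGraph P) (v x : P) : Prop :=
  ∃ c d : P, IsFace T v x c ∧ IsFace T x v d ∧ 0 < det3 (v : Plane) c d

/-- The Grassmann–Plücker relation. -/
lemma det3_plucker (v x c d w : Plane) : det3 v x c * det3 v w d + det3 v c d * det3 v w x +
    det3 v d x * det3 v w c = 0 := by unfold det3; ring

/-- All further edges at a reflex angle lie in the opposite cone. -/
lemma mem_cone_of_reflex (hP : GeneralPosition P) (hT : IsPlane T) {v x c d y : P}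
    (hc : IsFace T v x c) (hd : IsFace T x v d) (hcd : 0 < det3 (v : Plane) c d) (hy : T.Adj v y)
    (hyx : y ≠ x) (hyc : y ≠ c) (hyd : y ≠ d) :
    0 < det3 (v : Plane) c y ∧ 0 < det3 (v : Plane) y d := by
  have n1 : det3 (v : Plane) y x ≠ 0 := hP.det3_ne_zero hy.ne hc.ab.ne hyx
  have n2 : det3 (v : Plane) y c ≠ 0 := hP.det3_ne_zero hy.ne hc.ca.ne' hyc
  have n3 : det3 (v : Plane) y d ≠ 0 := hP.det3_ne_zero hy.ne hd.bc.ne hyd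
  have k1 := hc.not_mem_cone hT hy
  have k2 := hd.rotate.not_mem_cone hT hy
  have p1 := hc.pos
  have p2 := hd.rotate.pos
  have key := det3_plucker (v : Plane) x c d y
  rw [det3_swap' (v : Plane) y x] at k1
  rw [det3_swap' (v : Plane) y d] at k2
  rw [det3_swap' (v : Plane) y c]
  rcases lt_or_gt_of_ne n1 with h | h
  · have h2 : det3 (v : Plane) y c < 0 := by
      refine lt_of_le_of_ne (not_lt.1 fun h2 => k1 ⟨by linarith, h2⟩) n2
    refine ⟨by linarith, ?_⟩
    by_contra h3
    push Not at h3
    have := mul_nonpos_of_nonneg_of_nonpos p1.le h3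
    have := mul_neg_of_pos_of_neg hcd h
    have := mul_neg_of_pos_of_neg p2 h2
    linarith
  · have h3 : 0 < det3 (v : Plane) y d := by
      refine lt_of_le_of_ne (not_lt.1 fun h2 => k2 ⟨by linarith, h⟩) n3.symm
    refine ⟨?_, h3⟩
    by_contra h2
    push Not at h2
    have h2 : 0 ≤ det3 (v : Plane) y c := by linarith
    have := mul_pos p1 h3
    have := mul_pos hcd h
    have := mul_nonneg p2.le h2
    linarith

/-- Two edges with reflex angle at the same vertex bound a common face. -/
lemma IsReflex.isFace_or (hP : GeneralPosition P) (hT : IsPlane T) {v x y : P}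
    (hx : IsReflex T v x) (hy : IsReflex T v y) (hxy : x ≠ y) : IsFace T v x y ∨ IsFace T v y x := by
  obtain ⟨c, d, hc, hd, hcd⟩ := hx
  obtain ⟨c', d', hc', hd', hcd'⟩ := hy
  by_cases h1 : y = c
  · exact Or.inl (h1 ▸ hc)
  by_cases h2 : y = d
  · exact Or.inr (h2 ▸ hd.rotate)
  by_cases h3 : c' = x
  · exact Or.inr (h3 ▸ hc')
  by_cases h4 : d' = x
  · exact Or.inl (h4 ▸ hd'.rotate)
  exfalso
  -- Here `y` lies strictly, and `c'`, `d'` weakly, to the left of `vc`. But `y`, `c'`, `d'`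
  -- surround `v`, so they cannot share a half-plane in this way.
  have hy := (mem_cone_of_reflex hP hT hc hd hcd hc'.ab hxy.symm h1 h2).1
  have weak : ∀ p : P, T.Adj v p → p ≠ x → 0 ≤ det3 (v : Plane) c p := by
    intro p hp hpx
    by_cases e1 : p = c
    · rw [e1]; simp
    by_cases e2 : p = d
    · rw [e2]; exact hcd.le
    exact (mem_cone_of_reflex hP hT hc hd hcd hp hpx e1 e2).1.le
  have w1 := weak c' hc'.ca.symm h3
  have w2 := weak d' hd'.bc h4
  have key := det3_plucker (v : Plane) y c' d' c
  have p1 := hc'.pos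
  have p2 := hd'.rotate.pos
  have := mul_nonneg p1.le w2
  have := mul_pos hcd' hy
  have := mul_nonneg p2.le w1
  linarith

/-- There is no reflex angle at a convex hull vertex. -/
lemma IsReflex.exists_left (hP : GeneralPosition P) {v x w : P} (hx : IsReflex T v x)
    (hvw : v ≠ w) : ∃ p : P, 0 < det3 (v : Plane) w p := by
  by_contra hcon
  push Not at hcon
  obtain ⟨c, d, hc, hd, hcd⟩ := hx
  -- The points `x`, `c`, `d` surround `v`. If none is left of `vw`, every term of the relation
  -- vanishes, and `x` and `c` both coincide with `w`.
  have key := det3_plucker (v : Plane) x c d w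
  have p1 := hc.pos
  have p2 := hd.rotate.pos
  have m1 := mul_nonneg p1.le (neg_nonneg.2 (hcon d))
  have m2 := mul_nonneg hcd.le (neg_nonneg.2 (hcon x))
  have m3 := mul_nonneg p2.le (neg_nonneg.2 (hcon c))
  have e2 : det3 (v : Plane) c d * det3 (v : Plane) w x = 0 := by linarith
  have e3 : det3 (v : Plane) d x * det3 (v : Plane) w c = 0 := by linarith
  have e2 := (mul_eq_zero.1 e2).resolve_left hcd.ne'
  have e3 := (mul_eq_zero.1 e3).resolve_left p2.ne'
  have f2 := (hP.eq_or_eq hvw e2).resolve_left hc.ab.ne'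
  have f3 := (hP.eq_or_eq hvw e3).resolve_left hc.ca.ne
  exact hc.bc.ne (f2.trans f3.symm)

/-- Splitting the quadrilateral along either diagonal gives the same area, so `det3 v c d + det3 x d
c = -(det3 v x c + det3 x v d)`, which is negative. -/
lemma IsReflex.not_symm (hP : GeneralPosition P) (hT : IsPlane T) {v x : P} (h : IsReflex T v x) :
    ¬ IsReflex T x v := by
  rintro ⟨d', c', hd', hc', h'⟩
  obtain ⟨c, d, hc, hd, hcd⟩ := h
  obtain rfl := hc.unique hP hT hc'
  obtain rfl := hd.unique hP hT hd'
  have p1 := hc.pos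
  have p2 := hd.pos
  unfold det3 at *
  linarith

lemma IsConvexPair.swap {a b c d : P} (h : IsConvexPair T a b c d) : IsConvexPair T b a d c :=
  ⟨h.right, h.left, by rw [← det3_rotate]; exact (det3_rotate (c : Plane) d b ▸ h.pos'),
    by rw [det3_rotate (d : Plane)]; exact h.pos⟩

lemma IsConvexPair.not_isReflex (hP : GeneralPosition P) (hT : IsPlane T) {a b c d : P}
    (h : IsConvexPair T a b c d) : ¬ IsReflex T a b := by
  rintro ⟨c', d', hc', hd', h'⟩
  obtain rfl := h.left.unique hP hT hc'
  obtain rfl := h.right.unique hP hT hd'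
  have := h.pos
  rw [← det3_rotate, det3_swap'] at this
  rw [← det3_rotate] at h'
  unfold det3 at *
  linarith

/-- The diagonal of two adjacent faces is flippable or has a reflex angle at one end. -/
lemma exists_isConvexPair_or_isReflex (hP : GeneralPosition P) {a b c d : P}
    (hc : IsFace T a b c) (hd : IsFace T b a d) :
    IsConvexPair T a b c d ∨ IsReflex T a b ∨ IsReflex T b a := by
  have hcd : d ≠ c := by
    rintro rfl
    have h1 := hc.pos
    have h2 := hd.pos
    rw [det3_swap] at h2
    linarith
  have n1 : det3 (d : Plane) c a ≠ 0 := hP.det3_ne_zero hcd hd.bc.ne' hc.ca.ne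
  have n2 : det3 (d : Plane) b c ≠ 0 := hP.det3_ne_zero hd.ca.ne hcd hc.bc.ne
  rcases lt_or_gt_of_ne n1 with h | h
  · refine Or.inr (Or.inl ⟨c, d, hc, hd, ?_⟩)
    unfold det3 at *; linarith
  rcases lt_or_gt_of_ne n2 with h' | h'
  · refine Or.inr (Or.inr ⟨d, c, hd, hc, ?_⟩)
    unfold det3 at *; linarith
  · exact Or.inl ⟨hc, hd, h, h'⟩

/-! ### Counting faces and hull edges by a sweep -/

/-- An affine function that separates the points of a finite set. -/
lemma exists_isAff_injective (P : Finset Plane) :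
    ∃ l : Plane → ℝ, IsAff l ∧ ∀ p q : P, l p = l q → p = q := by
  -- Each pair of distinct points rules out at most one slope `t`.
  have hfin : (⋃ pq : {pq : P × P // pq.1 ≠ pq.2},
      {t : ℝ | (pq.1.1 : Plane) 0 + t * (pq.1.1 : Plane) 1 =
        (pq.1.2 : Plane) 0 + t * (pq.1.2 : Plane) 1}).Finite := by
    refine Set.finite_iUnion fun pq => Set.Subsingleton.finite ?_
    intro s hs t ht
    simp only [Set.mem_ofPred_eq] at hs ht
    by_contra hst
    have h1 : (s - t) * ((pq.1.1 : Plane) 1 - (pq.1.2 : Plane) 1) = 0 := by linarith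
    have h2 := (mul_eq_zero.1 h1).resolve_left (sub_ne_zero.2 hst)
    have h3 : (pq.1.1 : Plane) 1 = (pq.1.2 : Plane) 1 := by linarith
    rw [h3] at hs
    exact pq.2 (Subtype.ext (plane_ext (by linarith) h3))
  obtain ⟨t, ht⟩ := hfin.infinite_compl.nonempty
  refine ⟨fun u => u 0 + t * u 1, ⟨0, 1, t, fun u => by ring⟩, fun p q h => ?_⟩
  by_contra hne
  exact ht (Set.mem_iUnion.2 ⟨⟨(p, q), hne⟩, h⟩)

section Counting
open Classical

/-- If a property of triples fails for the rotations of each triple that has it, then at most a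
third of the triples in a rotation invariant set have it. -/
lemma three_mul_card_filter_le {V : Type*} (S : Finset (V × V × V))
    (hrot : ∀ a b c, (a, b, c) ∈ S → (b, c, a) ∈ S) (Q : V → V → V → Prop)
    [∀ a b c, Decidable (Q a b c)]
    (hQ : ∀ a b c, (a, b, c) ∈ S → Q a b c → ¬ Q b c a) :
    3 * (S.filter fun t => Q t.1 t.2.1 t.2.2).card ≤ S.card := by
  let S₁ := S.filter fun t => Q t.1 t.2.1 t.2.2
  let S₂ := S.filter fun t => Q t.2.1 t.2.2 t.1
  let S₃ := S.filter fun t => Q t.2.2 t.1 t.2.1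
  have h12 : S₁.card ≤ S₂.card := by
    refine Finset.card_le_card_of_injOn (fun t => (t.2.2, t.1, t.2.1)) ?_ ?_
    · rintro ⟨a, b, c⟩ h
      simp only [S₁, S₂, Finset.coe_filter, Set.mem_ofPred_eq] at h ⊢
      exact ⟨hrot _ _ _ (hrot _ _ _ h.1), h.2⟩
    · rintro ⟨a, b, c⟩ - ⟨a', b', c'⟩ - h
      simp only [Prod.mk.injEq] at h ⊢
      tauto
  have h13 : S₁.card ≤ S₃.card := by
    refine Finset.card_le_card_of_injOn (fun t => (t.2.1, t.2.2, t.1)) ?_ ?_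
    · rintro ⟨a, b, c⟩ h
      simp only [S₁, S₃, Finset.coe_filter, Set.mem_ofPred_eq] at h ⊢
      exact ⟨hrot _ _ _ h.1, h.2⟩
    · rintro ⟨a, b, c⟩ - ⟨a', b', c'⟩ - h
      simp only [Prod.mk.injEq] at h ⊢
      tauto
  have d12 : Disjoint S₁ S₂ := by
    rw [Finset.disjoint_left]
    rintro ⟨a, b, c⟩ h h'
    simp only [S₁, S₂, Finset.mem_filter] at h h'
    exact hQ a b c h.1 h.2 h'.2
  have d123 : Disjoint (S₁ ∪ S₂) S₃ := by
    rw [Finset.disjoint_left]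
    rintro ⟨a, b, c⟩ h h'
    simp only [S₁, S₂, S₃, Finset.mem_filter, Finset.mem_union] at h h'
    rcases h with h | h
    · exact hQ c a b (hrot _ _ _ (hrot _ _ _ h.1)) h'.2 h.2
    · exact hQ b c a (hrot _ _ _ h.1) h.2 h'.2
  have hle : ((S₁ ∪ S₂) ∪ S₃).card ≤ S.card := by
    refine Finset.card_le_card ?_
    refine Finset.union_subset (Finset.union_subset ?_ ?_) ?_ <;> exact Finset.filter_subset _ _
  rw [Finset.card_union_of_disjoint d123, Finset.card_union_of_disjoint d12] at hle
  change 3 * S₁.card ≤ S.card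
  omega

/-- The directed edges. -/
noncomputable def darts (T : SimpleGraph P) : Finset (P × P) := {e | T.Adj e.1 e.2}
/-- The faces, as triples of vertices in counterclockwise order. -/
noncomputable def faces (T : SimpleGraph P) : Finset (P × P × P) := {t | IsFace T t.1 t.2.1 t.2.2}
/-- The directed edges without a point of `P` to their left. -/
noncomputable def hullDarts (T : SimpleGraph P) : Finset (P × P) :=
  {e | T.Adj e.1 e.2 ∧ ∀ p : P, det3 (e.1 : Plane) e.2 p ≤ 0}
/-- The pairs `(v, x)` such that the quadrilateral with diagonal `vx` has a reflex angle at `v`. -/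
noncomputable def reflexDarts (T : SimpleGraph P) : Finset (P × P) := {e | IsReflex T e.1 e.2}
/-- The faces `vxy` such that `vx` and `vy` both have a reflex angle at `v`. -/
noncomputable def reflexFaces (T : SimpleGraph P) : Finset (P × P × P) :=
  (faces T).filter fun t => IsReflex T t.1 t.2.1 ∧ IsReflex T t.1 t.2.2
/-- The directed edges that are diagonals of convex quadrilaterals. -/
noncomputable def convexDarts (T : SimpleGraph P) : Finset (P × P) :=
  {e | ∃ c d, IsConvexPair T e.1 e.2 c d}

lemma mem_faces {a b c : P} : (a, b, c) ∈ faces T ↔ IsFace T a b c := by simp [faces]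

lemma faces_rotate (a b c : P) (h : (a, b, c) ∈ faces T) : (b, c, a) ∈ faces T :=
  mem_faces.2 (mem_faces.1 h).rotate

/-- A directed edge has at most one face to its left, and none if it is a hull dart. -/
lemma card_faces_add_le (hP : GeneralPosition P) (hT : IsPlane T) :
    (faces T).card + (hullDarts T).card ≤ (darts T).card := by
  have hinj : ((faces T).image (fun t => (t.1, t.2.1))).card = (faces T).card := by
    refine Finset.card_image_of_injOn ?_
    rintro ⟨a, b, c⟩ h ⟨a', b', c'⟩ h' e
    simp only [Prod.mk.injEq] at e
    obtain ⟨rfl, rfl⟩ := e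
    rw [(mem_faces.1 h).unique hP hT (mem_faces.1 h')]
  rw [← hinj, ← Finset.card_union_of_disjoint]
  · refine Finset.card_le_card (Finset.union_subset ?_ ?_)
    · rintro ⟨a, b⟩ h
      obtain ⟨⟨a', b', c⟩, hf, e⟩ := Finset.mem_image.1 h
      simp only [Prod.mk.injEq] at e
      obtain ⟨rfl, rfl⟩ := e
      simpa [darts] using (mem_faces.1 hf).ab
    · rintro ⟨a, b⟩ h
      simp only [hullDarts, darts, Finset.mem_filter, Finset.mem_univ, true_and] at h ⊢
      exact h.1
  · rw [Finset.disjoint_left]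
    rintro ⟨a, b⟩ h h'
    obtain ⟨⟨a', b', c⟩, hf, e⟩ := Finset.mem_image.1 h
    simp only [Prod.mk.injEq] at e
    obtain ⟨rfl, rfl⟩ := e
    simp only [hullDarts, Finset.mem_filter, Finset.mem_univ, true_and] at h'
    exact (h'.2 c).not_gt (mem_faces.1 hf).pos

/-- Of two such edges at `a`, neither has the other's end to its left, so both ends are on one line
through `a`. Hull darts therefore count distinct hull vertices. -/
lemma hullDarts_fst_injOn (hP : GeneralPosition P) :
    Set.InjOn Prod.fst (hullDarts T : Set (P × P)) := by
  rintro ⟨a, b⟩ h ⟨a', b'⟩ h' e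
  simp only at e
  subst e
  simp only [hullDarts, Finset.coe_filter, Finset.mem_univ, true_and, Set.mem_ofPred_eq] at h h'
  have h1 := h.2 b'
  have h2 := h'.2 b
  rw [det3_swap'] at h2
  rcases hP.eq_or_eq h.1.ne (by linarith : det3 (a : Plane) b b' = 0) with h3 | h3
  · exact absurd h3 h'.1.ne'
  · rw [h3]

/-- Every vertex that is not maximal for `l` is the middle vertex of a face lying above it, or the
start of a hull edge. -/
lemma card_le_middle (hP : GeneralPosition P) (hT : IsFullTriangulation T) {l : Plane → ℝ}
    (hl : IsAff l) (hinj : ∀ p q : P, l p = l q → p = q) (hne : Nonempty P) :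
    P.card ≤ ((faces T).filter fun t => l t.2.2 < l t.1 ∧ l t.1 < l t.2.1).card +
      ((hullDarts T).filter fun e => l e.1 < l e.2).card + 1 := by
  obtain ⟨m, -, hm⟩ := Finset.exists_max_image (Finset.univ : Finset P) (fun p => l p)
    Finset.univ_nonempty
  let A := (faces T).filter fun t => l t.2.2 < l t.1 ∧ l t.1 < l t.2.1
  let B := (hullDarts T).filter fun e => l e.1 < l e.2
  have hcov : (Finset.univ : Finset P) ⊆ (A.image Prod.fst ∪ B.image Prod.fst) ∪ {m} := by
    intro v _
    by_cases hvm : v = m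
    · simp [hvm]
    have hlt : l v < l m := lt_of_le_of_ne (hm v (Finset.mem_univ v)) fun h => hvm (hinj _ _ h)
    obtain ⟨r₀, hr₀, hr₀'⟩ := hT.exists_adj_gt hP hl hlt
    -- the counterclockwise-most edge to a higher vertex
    obtain ⟨r, hr, hlast⟩ : ∃ r : P, (T.Adj v r ∧ l v < l r) ∧
        ∀ r' : P, T.Adj v r' → l v < l r' → det3 (v : Plane) r r' ≤ 0 := by
      -- Swapping the coordinates reverses orientation and turns the clockwise-most choice into the
      -- counterclockwise-most one.
      have hrefl := exists_first ({r | T.Adj v r ∧ l v < l r} : Finset P) ⟨r₀, by simp [hr₀, hr₀']⟩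
        (fun r : P => WithLp.toLp 2 ![(r : Plane) 1, (r : Plane) 0])
        (g := fun u => l (WithLp.toLp 2 ![u 1, u 0])) (by
          obtain ⟨α, β, γ, e⟩ := hl
          exact ⟨α, γ, β, fun u => by simp only [e]; simp; ring⟩) (WithLp.toLp 2 ![(v : Plane) 1, (v : Plane) 0])
        (by
          intro c hc
          have e : ∀ u : Plane, (WithLp.toLp 2 ![u 0, u 1] : Plane) = u := fun u =>
            plane_ext (by simp) (by simp)
          simpa [e] using ((Finset.mem_filter.1 hc).2).2)
      obtain ⟨r, hr, h⟩ := hrefl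
      refine ⟨r, (Finset.mem_filter.1 hr).2, fun r' h1 h2 => ?_⟩
      have := h r' (by simp [h1, h2])
      simp only [det3] at this ⊢
      simp at this
      linarith
    rw [Finset.mem_union, Finset.mem_union]
    left
    by_cases hw : ∃ w : P, 0 < det3 (v : Plane) r w
    · obtain ⟨w, hw⟩ := hw
      obtain ⟨z, hz⟩ := hT.exists_face hP hr.1 hw
      left
      refine Finset.mem_image.2 ⟨(v, r, z), ?_, rfl⟩
      refine Finset.mem_filter.2 ⟨mem_faces.2 hz, ?_, hr.2⟩
      have hle : l z ≤ l v := by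
        by_contra hc
        push Not at hc
        exact (hlast z hz.ca.symm hc).not_gt hz.pos
      exact lt_of_le_of_ne hle fun h => hz.ca.ne (hinj _ _ h)
    · push Not at hw
      right
      refine Finset.mem_image.2 ⟨(v, r), ?_, rfl⟩
      exact Finset.mem_filter.2 ⟨by simpa [hullDarts] using ⟨hr.1, fun x hx => hw ⟨x, hx⟩⟩, hr.2⟩
  have h1 := Finset.card_le_card hcov
  have h2 := Finset.card_union_le (A.image Prod.fst ∪ B.image Prod.fst) {m}
  have h3 := Finset.card_union_le (A.image Prod.fst) (B.image Prod.fst)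
  have h4 : (A.image Prod.fst).card ≤ A.card := Finset.card_image_le
  have h5 : (B.image Prod.fst).card ≤ B.card := Finset.card_image_le
  rw [Finset.card_univ, Fintype.card_coe] at h1
  rw [Finset.card_singleton] at h2
  change P.card ≤ A.card + B.card + 1
  omega

/-- The number of faces is at least `2n - h - 2`; `faces T` counts every face three times. -/
lemma six_mul_card_le (hP : GeneralPosition P) (hT : IsFullTriangulation T) (hne : Nonempty P) :
    6 * P.card ≤ (faces T).card + 3 * (hullDarts T).card + 6 := by
  obtain ⟨l, hl, hinj⟩ := exists_isAff_injective P
  have u := card_le_middle hP hT hl hinj hne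
  have d := card_le_middle hP hT hl.neg (fun p q h => hinj p q (neg_injective h)) hne
  simp only [neg_lt_neg_iff] at d
  have hB : ((hullDarts T).filter fun e => l e.1 < l e.2).card +
      ((hullDarts T).filter fun e => l e.2 < l e.1).card ≤ (hullDarts T).card := by
    rw [← Finset.card_union_of_disjoint]
    · exact Finset.card_le_card (Finset.union_subset (Finset.filter_subset _ _)
        (Finset.filter_subset _ _))
    · rw [Finset.disjoint_left]
      intro e h h'
      exact lt_asymm (Finset.mem_filter.1 h).2 (Finset.mem_filter.1 h').2
  have hA : ((faces T).filter fun t => l t.2.2 < l t.1 ∧ l t.1 < l t.2.1).card +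
      ((faces T).filter fun t => l t.1 < l t.2.2 ∧ l t.2.1 < l t.1).card ≤
      ((faces T).filter fun t => (l t.2.2 < l t.1 ∧ l t.1 < l t.2.1) ∨
        (l t.1 < l t.2.2 ∧ l t.2.1 < l t.1)).card := by
    rw [← Finset.card_union_of_disjoint, Finset.filter_or]
    rw [Finset.disjoint_left]
    intro e h h'
    exact lt_asymm (Finset.mem_filter.1 h).2.1 (Finset.mem_filter.1 h').2.1
  -- A face has only one middle vertex for `l`, so the upward and downward sweeps together charge it
  -- at most once.
  have h3 := three_mul_card_filter_le (faces T) faces_rotate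
    (fun a b c => (l c < l a ∧ l a < l b) ∨ (l a < l c ∧ l b < l a)) (by
      rintro a b c - (h | h) (h' | h') <;> linarith [h.1, h.2, h'.1, h'.2])
  omega

/-! ### Counting reflex angles -/

/-- Any two of the `k` reflex edges at `v` bound a common face, so at least `k(k - 1)/2` reflex
faces have their corner at `v`. This is at least `2k - 3` because `(k - 2)(k - 3) ≥ 0`. -/
lemma two_mul_card_reflex_at (hP : GeneralPosition P) (hT : IsPlane T) (v : P) :
    2 * ((reflexDarts T).filter fun e => e.1 = v).card ≤
      3 + ((reflexFaces T).filter fun t => t.1 = v).card := by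
  let R : Finset P := {x | IsReflex T v x}
  let B : Finset (P × P) := {e | IsFace T v e.1 e.2 ∧ IsReflex T v e.1 ∧ IsReflex T v e.2}
  have hR : ((reflexDarts T).filter fun e => e.1 = v).card ≤ R.card := by
    refine Finset.card_le_card_of_injOn Prod.snd ?_ ?_
    · rintro ⟨a, b⟩ h
      simp only [reflexDarts, Finset.coe_filter, Finset.mem_filter, Finset.mem_univ, true_and,
        Set.mem_ofPred_eq, R] at h ⊢
      obtain ⟨h, rfl⟩ := h
      exact h
    · rintro ⟨a, b⟩ h ⟨a', b'⟩ h' e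
      simp only [Finset.coe_filter, Set.mem_ofPred_eq] at h h' e
      rw [h.2, h'.2, e]
  have hB : B.card ≤ ((reflexFaces T).filter fun t => t.1 = v).card := by
    refine Finset.card_le_card_of_injOn (fun e => (v, e)) ?_ ?_
    · rintro ⟨a, b⟩ h
      simp only [reflexFaces, faces, Finset.coe_filter, Finset.mem_filter, Finset.mem_univ,
        true_and, Set.mem_ofPred_eq, B] at h ⊢
      exact ⟨h, trivial⟩
    · rintro e - e' - h
      exact (Prod.mk.inj h).2
  have hoff : R.offDiag ⊆ B ∪ B.image Prod.swap := by
    rintro ⟨x, y⟩ h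
    obtain ⟨hx, hy, hxy⟩ := Finset.mem_offDiag.1 h
    have hx : IsReflex T v x := by simpa [R] using hx
    have hy : IsReflex T v y := by simpa [R] using hy
    rw [Finset.mem_union]
    rcases hx.isFace_or hP hT hy hxy with h | h
    · exact Or.inl (by simp [B, h, hx, hy])
    · exact Or.inr (Finset.mem_image.2 ⟨(y, x), by simp [B, h, hx, hy], rfl⟩)
  have h1 := Finset.card_le_card hoff
  have h2 := Finset.card_union_le B (B.image Prod.swap)
  have h3 : (B.image Prod.swap).card ≤ B.card := Finset.card_image_le
  rw [Finset.offDiag_card] at h1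
  have h4 : 5 * R.card ≤ R.card * R.card + 6 := by
    have : R.card ≤ 2 ∨ 3 ≤ R.card := by omega
    rcases this with h | h
    · interval_cases R.card <;> omega
    · obtain ⟨k, hk⟩ := Nat.exists_eq_add_of_le h
      rw [hk]; nlinarith [Nat.zero_le k]
  omega

/-- Summation of the local bound over the vertices; hull vertices have no reflex angle and save
their `3`. -/
lemma two_mul_card_reflexDarts_le (hP : GeneralPosition P) (hT : IsPlane T) :
    2 * (reflexDarts T).card + 3 * (hullDarts T).card ≤ 3 * P.card + (reflexFaces T).card := by
  let H := (hullDarts T).image Prod.fst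
  have hH : H.card = (hullDarts T).card := Finset.card_image_of_injOn (hullDarts_fst_injOn hP)
  have hR : (reflexDarts T).card =
      ∑ v : P, ((reflexDarts T).filter fun e => e.1 = v).card :=
    Finset.card_eq_sum_card_fiberwise fun _ _ => Finset.mem_coe.2 (Finset.mem_univ _)
  have hB : (reflexFaces T).card =
      ∑ v : P, ((reflexFaces T).filter fun t => t.1 = v).card :=
    Finset.card_eq_sum_card_fiberwise fun _ _ => Finset.mem_coe.2 (Finset.mem_univ _)
  have hHs : 3 * H.card = ∑ v : P, if v ∈ H then 3 else 0 := by
    rw [Finset.sum_ite_mem, Finset.univ_inter, Finset.sum_const, smul_eq_mul, mul_comm]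
  have hPs : 3 * P.card = ∑ v : P, 3 := by
    rw [Finset.sum_const, Finset.card_univ, Fintype.card_coe, smul_eq_mul, mul_comm]
  rw [← hH, hR, hB, hHs, hPs, Finset.mul_sum, ← Finset.sum_add_distrib, ← Finset.sum_add_distrib]
  refine Finset.sum_le_sum fun v _ => ?_
  by_cases hv : v ∈ H
  · obtain ⟨⟨v', w⟩, hw, rfl⟩ := Finset.mem_image.1 hv
    simp only [hullDarts, Finset.mem_filter, Finset.mem_univ, true_and] at hw
    have : ((reflexDarts T).filter fun e => e.1 = v') = ∅ := by
      refine Finset.filter_eq_empty_iff.2 ?_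
      rintro ⟨a, b⟩ h rfl
      simp only [reflexDarts, Finset.mem_filter, Finset.mem_univ, true_and] at h
      obtain ⟨p, hp⟩ := h.exists_left hP hw.1.ne
      exact (hw.2 p).not_gt hp
    rw [if_pos hv, this]; simp
  · rw [if_neg hv]
    simpa using two_mul_card_reflex_at hP hT v

/-- An edge with points on both sides bounds two faces, which form a convex quadrilateral or one
with a reflex angle at an end of the edge. The factors `2` account for both directions of an edge.
-/
lemma card_darts_le_convex (hP : GeneralPosition P) (hT : IsFullTriangulation T) :
    (darts T).card ≤ 2 * (hullDarts T).card + 2 * (reflexDarts T).card + (convexDarts T).card := by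
  have hcov : darts T ⊆ ((hullDarts T ∪ (hullDarts T).image Prod.swap) ∪
      (reflexDarts T ∪ (reflexDarts T).image Prod.swap)) ∪ convexDarts T := by
    rintro ⟨a, b⟩ hab
    have hab : T.Adj a b := by simpa [darts] using hab
    simp only [Finset.mem_union]
    by_cases h1 : ∀ p : P, det3 (a : Plane) b p ≤ 0
    · exact Or.inl (Or.inl (Or.inl (by simpa [hullDarts] using ⟨hab, fun x hx => h1 ⟨x, hx⟩⟩)))
    by_cases h2 : ∀ p : P, det3 (b : Plane) a p ≤ 0
    · exact Or.inl (Or.inl (Or.inr (Finset.mem_image.2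
        ⟨(b, a), by simpa [hullDarts] using ⟨hab.symm, fun x hx => h2 ⟨x, hx⟩⟩, rfl⟩)))
    push Not at h1 h2
    obtain ⟨p, hp⟩ := h1
    obtain ⟨q, hq⟩ := h2
    obtain ⟨c, hc⟩ := hT.exists_face hP hab hp
    obtain ⟨d, hd⟩ := hT.exists_face hP hab.symm hq
    rcases exists_isConvexPair_or_isReflex hP hc hd with h | h | h
    · exact Or.inr (Finset.mem_filter.2 ⟨Finset.mem_univ _, c, d, h⟩)
    · exact Or.inl (Or.inr (Or.inl (by simpa [reflexDarts] using h)))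
    · exact Or.inl (Or.inr (Or.inr (Finset.mem_image.2
        ⟨(b, a), by simpa [reflexDarts] using h, rfl⟩)))
  have h1 := Finset.card_le_card hcov
  have h2 := Finset.card_union_le ((hullDarts T ∪ (hullDarts T).image Prod.swap) ∪
      (reflexDarts T ∪ (reflexDarts T).image Prod.swap)) (convexDarts T)
  have h3 := Finset.card_union_le (hullDarts T ∪ (hullDarts T).image Prod.swap)
      (reflexDarts T ∪ (reflexDarts T).image Prod.swap)
  have h4 := Finset.card_union_le (hullDarts T) ((hullDarts T).image Prod.swap)
  have h5 := Finset.card_union_le (reflexDarts T) ((reflexDarts T).image Prod.swap)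
  have h6 : ((hullDarts T).image Prod.swap).card ≤ (hullDarts T).card := Finset.card_image_le
  have h7 : ((reflexDarts T).image Prod.swap).card ≤ (reflexDarts T).card := Finset.card_image_le
  omega

/-! ### The dual graph on flippable edges -/

/-- The diagonals of convex quadrilaterals. -/
noncomputable def convexEdges (T : SimpleGraph P) : Finset (Sym2 P) :=
  (convexDarts T).image fun e => s(e.1, e.2)

lemma mem_convexEdges {a b : P} : s(a, b) ∈ convexEdges T ↔ ∃ c d, IsConvexPair T a b c d := by
  constructor
  · intro hm
    obtain ⟨⟨a', b'⟩, hf, e⟩ := Finset.mem_image.1 hm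
    obtain ⟨-, c, d, h⟩ := Finset.mem_filter.1 hf
    rcases Sym2.eq_iff.1 e with ⟨rfl, rfl⟩ | ⟨rfl, rfl⟩
    · exact ⟨c, d, h⟩
    · exact ⟨d, c, h.swap⟩
  · intro h
    exact Finset.mem_image.2 ⟨(a, b), Finset.mem_filter.2 ⟨Finset.mem_univ _, h⟩, rfl⟩

lemma card_convexDarts_le : (convexDarts T).card ≤ 2 * (convexEdges T).card := by
  refine Finset.card_le_mul_card_image _ 2 ?_
  intro e _
  induction e with
  | h a b =>
    refine (Finset.card_le_card (t := {(a, b), (b, a)}) ?_).trans Finset.card_le_two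
    rintro ⟨a', b'⟩ h
    have := (Finset.mem_filter.1 h).2
    simp only [Finset.mem_insert, Finset.mem_singleton, Prod.mk.injEq]
    exact Sym2.eq_iff.1 this

/-- The vertex sets of faces, as nodes incident to the edges they contain. -/
def FaceIncident (T : SimpleGraph P) (t : Finset P) (e : Sym2 P) : Prop :=
  (∃ a b c, IsFace T a b c ∧ t = {a, b, c}) ∧ ∀ v ∈ e, v ∈ t

lemma faceIncident_triple {a b c p q : P} (h : IsFace T a b c) (hp : p ∈ ({a, b, c} : Finset P))
    (hq : q ∈ ({a, b, c} : Finset P)) : FaceIncident T {a, b, c} s(p, q) := by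
  refine ⟨⟨a, b, c, h, rfl⟩, fun v hv => ?_⟩
  rcases Sym2.mem_iff.1 hv with rfl | rfl <;> assumption

/-- A face with vertices `a` and `b` lies to the left of `ab` or of `ba`. -/
lemma FaceIncident.exists_face {t : Finset P} {a b : P} (h : FaceIncident T t s(a, b))
    (hab : a ≠ b) : ∃ c, (IsFace T a b c ∨ IsFace T b a c) ∧ t = {a, b, c} := by
  obtain ⟨⟨x, y, z, hf, rfl⟩, hv⟩ := h
  have ha := hv a (Sym2.mem_mk_left a b)
  have hb := hv b (Sym2.mem_mk_right a b)
  simp only [Finset.mem_insert, Finset.mem_singleton] at ha hb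
  have e1 : ∀ x y z : P, ({x, y, z} : Finset P) = {y, x, z} := fun x y z => Finset.insert_comm x y _
  have e2 : ∀ x y z : P, ({x, y, z} : Finset P) = {x, z, y} := fun x y z => by
    rw [Finset.pair_comm]
  rcases ha with rfl | rfl | rfl <;> rcases hb with rfl | rfl | rfl
  · exact absurd rfl hab
  · exact ⟨z, Or.inl hf, rfl⟩
  · exact ⟨y, Or.inr hf.rotate.rotate, e2 _ _ _⟩
  · exact ⟨z, Or.inr hf, e1 _ _ _⟩
  · exact absurd rfl hab
  · exact ⟨x, Or.inl hf.rotate, by rw [e1, e2]⟩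
  · exact ⟨y, Or.inl hf.rotate.rotate, by rw [e2, e1]⟩
  · exact ⟨x, Or.inr hf.rotate, by rw [e2, e1, e2]⟩
  · exact absurd rfl hab

lemma faceIncident_iff (hP : GeneralPosition P) (hT : IsPlane T) {a b c d : P}
    (h : IsConvexPair T a b c d) (t : Finset P) :
    FaceIncident T t s(a, b) ↔ t = {a, b, c} ∨ t = {a, b, d} := by
  constructor
  · intro ht
    obtain ⟨z, hz | hz, rfl⟩ := ht.exists_face h.left.ab.ne
    · rw [h.left.unique hP hT hz]; exact Or.inl rfl
    · rw [h.right.unique hP hT hz]; exact Or.inr rfl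
  · rintro (rfl | rfl)
    · exact faceIncident_triple h.left (by simp) (by simp)
    · rw [Finset.insert_comm]
      exact faceIncident_triple h.right (by simp) (by simp)

lemma IsConvexPair.ne {a b c d : P} (h : IsConvexPair T a b c d) : c ≠ d := by
  rintro rfl
  have h1 := h.left.pos
  have h2 := h.right.pos
  rw [det3_swap] at h2
  linarith

/-- Faces with at least two flippable edges are not charged to a reflex angle. -/
lemma card_le_one_of_isReflex (hP : GeneralPosition P) (hT : IsPlane T) {v x y : P}
    (hx : IsReflex T v x) (hy : IsReflex T v y) :
    ((convexEdges T).filter (FaceIncident T {v, x, y})).card ≤ 1 := by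
  -- Only the side opposite `v` can be flippable.
  refine (Finset.card_le_card (t := {s(x, y)}) ?_).trans (Finset.card_singleton _).le
  intro e he
  have key : ∀ w : P, IsReflex T v w → s(v, w) ∉ convexEdges T := by
    intro w hw h
    obtain ⟨c, d, h⟩ := mem_convexEdges.1 h
    exact h.not_isReflex hP hT hw
  have key' : ∀ w : P, IsReflex T v w → s(w, v) ∉ convexEdges T := by
    intro w hw
    rw [Sym2.eq_swap]
    exact key w hw
  induction e with
  | h p q =>
    obtain ⟨hm, -, hv⟩ := Finset.mem_filter.1 he
    clear he
    have hpq : p ≠ q := by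
      obtain ⟨c, d, h⟩ := mem_convexEdges.1 hm
      exact h.left.ab.ne
    have hp := hv p (Sym2.mem_mk_left p q)
    have hq := hv q (Sym2.mem_mk_right p q)
    simp only [Finset.mem_insert, Finset.mem_singleton] at hp hq
    rw [Finset.mem_singleton]
    rcases hp with rfl | rfl | rfl <;> rcases hq with rfl | rfl | rfl <;>
      first
      | rfl
      | exact Sym2.eq_swap
      | exact absurd rfl hpq
      | exact absurd hm (key _ hx)
      | exact absurd hm (key _ hy)
      | exact absurd hm (key' _ hx)
      | exact absurd hm (key' _ hy)

/-- The nodes with at least two flippable edges. -/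
noncomputable def richFaces (T : SimpleGraph P) : Finset (Finset P) :=
  {t | 2 ≤ ((convexEdges T).filter (FaceIncident T t)).card}

/-- Reflex faces have at most one flippable edge and so are not rich. By `IsReflex.not_symm` a face
is a reflex face for one corner only, so each accounts for three elements of `faces T`. -/
lemma card_richFaces_le (hP : GeneralPosition P) (hT : IsPlane T) :
    3 * (richFaces T).card + 3 * (reflexFaces T).card ≤ (faces T).card := by
  let K := (faces T).filter fun t => ({t.1, t.2.1, t.2.2} : Finset P) ∈ richFaces T
  have hrot : ∀ a b c : P, ({b, c, a} : Finset P) = {a, b, c} := by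
    intro a b c
    ext z; simp only [Finset.mem_insert, Finset.mem_singleton]; tauto
  have hK : 3 * (richFaces T).card ≤ K.card := by
    refine Finset.mul_card_image_le_card_of_maps_to
      (f := fun t : P × P × P => ({t.1, t.2.1, t.2.2} : Finset P))
      (fun t ht => (Finset.mem_filter.1 ht).2) 3 ?_
    intro t ht
    have ht' : 2 ≤ ((convexEdges T).filter (FaceIncident T t)).card := by
      simpa [richFaces] using ht
    obtain ⟨e, he⟩ := Finset.card_pos.1 (lt_of_lt_of_le two_pos ht')
    obtain ⟨⟨a, b, c, hf, rfl⟩, -⟩ := (Finset.mem_filter.1 he).2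
    have h1 : ({(a, b, c), (b, c, a), (c, a, b)} : Finset (P × P × P)).card = 3 := by
      rw [Finset.card_eq_three]
      have := hf.ab.ne
      have := hf.bc.ne
      have := hf.ca.ne
      exact ⟨_, _, _, by simp; tauto, by simp; tauto, by simp; tauto, rfl⟩
    rw [← h1]
    refine Finset.card_le_card ?_
    intro s hs
    simp only [Finset.mem_insert, Finset.mem_singleton] at hs
    rcases hs with rfl | rfl | rfl
    · simp only [Finset.mem_filter]
      exact ⟨⟨mem_faces.2 hf, ht⟩, trivial⟩
    · simp only [Finset.mem_filter, hrot a b c]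
      exact ⟨⟨mem_faces.2 hf.rotate, ht⟩, trivial⟩
    · simp only [Finset.mem_filter, ← hrot c a b]
      exact ⟨⟨mem_faces.2 hf.rotate.rotate, ht⟩, trivial⟩
  have hB : 3 * (reflexFaces T).card ≤ (faces T \ K).card := by
    have h3 := three_mul_card_filter_le (faces T \ K) (by
      intro a b c h
      simp only [Finset.mem_sdiff, Finset.mem_filter, K, hrot a b c] at h ⊢
      exact ⟨faces_rotate _ _ _ h.1, fun h' => h.2 ⟨h.1, h'.2⟩⟩)
      (fun v x y => IsReflex T v x ∧ IsReflex T v y)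
      (fun a b c _ h h' => h.1.not_symm hP hT h'.2)
    refine le_trans (Nat.mul_le_mul_left 3 (Finset.card_le_card ?_)) h3
    rintro ⟨v, x, y⟩ h
    obtain ⟨hf, hr⟩ := Finset.mem_filter.1 h
    refine Finset.mem_filter.2 ⟨Finset.mem_sdiff.2 ⟨hf, fun hk => ?_⟩, hr⟩
    have h2 := (Finset.mem_filter.1 hk).2
    simp only [richFaces, Finset.mem_filter, Finset.mem_univ, true_and] at h2
    exact absurd (h2.trans (card_le_one_of_isReflex hP hT hr.1 hr.2)) (by norm_num)
  have := Finset.card_sdiff_add_card_eq_card (show K ⊆ faces T from Finset.filter_subset _ _)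
  omega

/-- There is a large set of flippable edges no two of which lie in a common face. -/
lemma exists_matching_convexEdges (hP : GeneralPosition P) (hT : IsPlane T) :
    ∃ M ⊆ convexEdges T, (∀ e ∈ M, ∀ f ∈ M, e ≠ f → NoCommonFace T e f) ∧
      3 * (convexEdges T).card ≤ 5 * M.card + 4 * (richFaces T).card := by
  have two : ∀ e ∈ convexEdges T, ∃ x y : Finset P, x ≠ y ∧
      ∀ z, FaceIncident T z e ↔ z = x ∨ z = y := by
    intro e he
    induction e with
    | h a b =>
      obtain ⟨c, d, h⟩ := mem_convexEdges.1 he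
      refine ⟨{a, b, c}, {a, b, d}, ?_, faceIncident_iff hP hT h⟩
      intro e
      have : c ∈ ({a, b, d} : Finset P) := by rw [← e]; simp
      simp only [Finset.mem_insert, Finset.mem_singleton] at this
      rcases this with h' | h' | h'
      · exact h.left.ca.ne h'
      · exact h.left.bc.ne h'.symm
      · exact h.ne h'
  have simple : ∀ e ∈ convexEdges T, ∀ f ∈ convexEdges T, e ≠ f → ∀ x y, x ≠ y → FaceIncident T x e →
      FaceIncident T y e → FaceIncident T x f → FaceIncident T y f → False := by
    intro e he f hf hef x y hxy hxe hye hxf hyf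
    induction e with
    | h a b =>
    induction f with
    | h p q =>
      obtain ⟨c, d, h⟩ := mem_convexEdges.1 he
      obtain ⟨c', d', h'⟩ := mem_convexEdges.1 hf
      have hcd := h.ne
      have hpq := h'.left.ab.ne
      have hp := hxf.2 p (Sym2.mem_mk_left p q)
      have hq := hxf.2 q (Sym2.mem_mk_right p q)
      have hp' := hyf.2 p (Sym2.mem_mk_left p q)
      have hq' := hyf.2 q (Sym2.mem_mk_right p q)
      -- The two nodes of the edge `ab` share only its endpoints, so an edge contained in both is
      -- `ab` itself.
      have both : ∀ p, p ∈ x → p ∈ y → p = a ∨ p = b := by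
        intro p h1 h2
        rcases (faceIncident_iff hP hT h x).1 hxe with rfl | rfl <;>
          rcases (faceIncident_iff hP hT h y).1 hye with rfl | rfl <;>
          simp only [Finset.mem_insert, Finset.mem_singleton] at h1 h2
        · exact absurd rfl hxy
        · rcases h1 with h1 | h1 | h1
          · exact Or.inl h1
          · exact Or.inr h1
          · rcases h2 with h2 | h2 | h2
            · exact Or.inl h2
            · exact Or.inr h2
            · exact absurd (h1.symm.trans h2) hcd
        · rcases h1 with h1 | h1 | h1
          · exact Or.inl h1
          · exact Or.inr h1
          · rcases h2 with h2 | h2 | h2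
            · exact Or.inl h2
            · exact Or.inr h2
            · exact absurd (h2.symm.trans h1) hcd
        · exact absurd rfl hxy
      apply hef
      rcases both p hp hp' with rfl | rfl <;> rcases both q hq hq' with rfl | rfl
      · exact absurd rfl hpq
      · rfl
      · exact Sym2.eq_swap
      · exact absurd rfl hpq
  have deg : ∀ t, ((convexEdges T).filter (FaceIncident T t)).card ≤ 3 := by
    intro t
    rcases ((convexEdges T).filter (FaceIncident T t)).eq_empty_or_nonempty with h | ⟨e, he⟩
    · rw [h]; simp
    obtain ⟨⟨a, b, c, hf, rfl⟩, -⟩ := (Finset.mem_filter.1 he).2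
    refine (Finset.card_le_card (t := {s(a, b), s(b, c), s(c, a)}) ?_).trans Finset.card_le_three
    intro f hf
    obtain ⟨hf, -, hv⟩ := Finset.mem_filter.1 hf
    induction f with
    | h p q =>
      obtain ⟨_, _, h⟩ := mem_convexEdges.1 hf
      have hpq := h.left.ab.ne
      have hp := hv p (Sym2.mem_mk_left p q)
      have hq := hv q (Sym2.mem_mk_right p q)
      simp only [Finset.mem_insert, Finset.mem_singleton] at hp hq
      simp only [Finset.mem_insert, Finset.mem_singleton, Sym2.eq_iff]
      rcases hp with rfl | rfl | rfl <;> rcases hq with rfl | rfl | rfl <;> first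
        | exact absurd rfl hpq
        | simp
  obtain ⟨M, hM, hd, hc⟩ := exists_matching (FaceIncident T) (convexEdges T) two simple deg
  refine ⟨M, hM, ?_, ?_⟩
  · intro e he f hf hef x y z hxyz h1 h2
    refine hd e he f hf hef {x, y, z} ⟨⟨x, y, z, hxyz, rfl⟩, ?_⟩ ⟨⟨x, y, z, hxyz, rfl⟩, ?_⟩
    · intro v hv; simpa using h1 v hv
    · intro v hv; simpa using h2 v hv
  · refine hc.trans (Nat.add_le_add_left ?_ _)
    rw [richFaces, Finset.card_filter, Finset.mul_sum]
    refine Finset.sum_le_sum fun t _ => ?_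
    unfold degreeWeight
    split_ifs <;> omega

lemma isFlippable_of_mem_convexEdges (hT : IsPlane T) {e : Sym2 P} (he : e ∈ convexEdges T) :
    IsFlippable T e := by
  induction e with
  | h a b =>
    obtain ⟨c, d, h⟩ := mem_convexEdges.1 he
    exact ⟨_, h.isOtherDiagonal_self hT⟩

lemma simultaneouslyFlippable_of_noCommonFace (hT : IsPlane T) {M : Finset (Sym2 P)}
    (hM : M ⊆ convexEdges T) (hd : ∀ e ∈ M, ∀ f ∈ M, e ≠ f → NoCommonFace T e f) :
    SimultaneouslyFlippable T (M : Set (Sym2 P)) := by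
  refine ⟨fun e he => isFlippable_of_mem_convexEdges hT (hM he), ?_⟩
  intro e he f hf hef
  have hN := hd e he f hf hef
  have he := hM he
  have hf := hM hf
  induction e with
  | h a b =>
  induction f with
  | h p q =>
    obtain ⟨c, d, h⟩ := mem_convexEdges.1 he
    obtain ⟨c', d', h'⟩ := mem_convexEdges.1 hf
    exact h.independentlyFlippable hT h' hef hN

end Counting
end PlaneTriangulation

/-! ### Combining the counts -/

theorem mainTheorem11 (P : Finset PlaneTriangulation.Plane)
    (hP : PlaneTriangulation.GeneralPosition P) (hn : 3 ≤ P.card)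
    (T : SimpleGraph P) (hT : PlaneTriangulation.IsFullTriangulation T) (α β : ℕ)
    (hα : α = {e : Sym2 P | PlaneTriangulation.IsFlippable T e}.ncard)
    (hβ : IsGreatest {k : ℕ | ∃ F : Set (Sym2 P),
      PlaneTriangulation.SimultaneouslyFlippable T F ∧ F.ncard = k} β) :
    4 * ((P.card : ℝ) - 4) / 5 ≤ (α : ℝ) + (β : ℝ) := by
  open PlaneTriangulation in
  have hne : Nonempty P := by
    obtain ⟨p, hp⟩ := Finset.card_pos.1 (show 0 < P.card by omega)
    exact ⟨⟨p, hp⟩⟩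
  have hpl := hT.prop
  obtain ⟨M, hM, hd, hc⟩ := exists_matching_convexEdges hP hpl
  have hMβ : M.card ≤ β := hβ.2 ⟨M, simultaneouslyFlippable_of_noCommonFace hpl hM hd,
    Set.ncard_coe_finset M⟩
  have hEα : (convexEdges T).card ≤ α := by
    rw [hα, ← Set.ncard_coe_finset]
    exact Set.ncard_le_ncard (fun e he => isFlippable_of_mem_convexEdges hpl he) (Set.toFinite _)
  have h1 := card_faces_add_le hP hpl
  have h2 := six_mul_card_le hP hT hne
  have h3 := two_mul_card_reflexDarts_le hP hpl
  have h4 := card_darts_le_convex hP hT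
  have h5 := card_convexDarts_le (T := T)
  have h6 := card_richFaces_le hP hpl
  -- The combination takes `hc` once, `h1`, `h3`, `h4`, `h5` four times, `h6` with factor `4/3` and
  -- `h2` with factor `8/3`; the numbers of reflex faces and of rich faces cancel.
  have key : 4 * P.card ≤ 5 * (α + β) + 16 := by omega
  have key' : 4 * (P.card : ℝ) ≤ 5 * ((α : ℝ) + β) + 16 := by exact_mod_cast key
  linarith
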